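/- **Theorem (improved Combes–Thomas estimate).** There is a universal constant $K>0$ such that the following holds. *Setting.* Let $\Lambda\subset\mathbb R^d$ be open, $\hbar,m_e>0$, $e\in\mathbb R$, $\mathbf A\in C^1(\Lambda,\mathbb R^d)$, $V_\Lambda\in L^\infty(\Lambda,\mathbb R)$, $\mathbf p=-i\hbar\nabla$, and let $$H_\Lambda=\frac1{2m_e}(\mathbf p+e\mathbf A)^2+V_\Lambda$$ on $L^2(\Lambda)$ with a boundary condition, that is: $H_\Lambda$ is the self-adjoint operator associated with the form $h(\varphi,\psi)=\frac1{2m_e}\langle(\mathbf p+e\mathbf A)\varphi,(\mathbf p+e\mathbf A)\psi\rangle+\langle\varphi,V_\Lambda\psi\rangle$ on a form domain $Q$ with $C_c^\infty(\Lambda)\subset Q\subset\{\psi\in L^2(\Lambda):(\mathbf p+e\mathbf A)\psi\in L^2(\Lambda)\text{ weakly}\}$, complete in the form norm, and stable under multiplication by all real $\eta\in C^\infty(\mathbb R^d)$ with $\eta,\nabla\eta$ bounded that are invariant under a fixed additive group $\Gamma\subset\mathbb R^d$ of translations. (Dirichlet, Neumann and mixed conditions: $\Gamma=\{0\}$; periodic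 conditions, possibly with magnetic phases, on a box: $\Gamma$ is the period lattice.) Let $(E_-,E_+)$ be a spectral gap of $H_\Lambda$, i.e. $(E_-,E_+)\cap\sigma(H_\Lambda)=\emptyset$ and $\sigma(H_\Lambda)\cap(-\infty,E_-]\neq\emptyset$, and let $E\in(E_-,E_+)$. Let $v,w$ be bounded functions with compact support, and put $$r=\operatorname{dist}(\operatorname{supp}v+\Gamma,\operatorname{supp}w),$$ so that $r=\operatorname{dist}(\operatorname{supp}v,\operatorname{supp}w)$ if $\Gamma=\{0\}$. Let $\delta>0$, let $j_\delta\in C_c^\infty(\mathbb R^d)$ with $j_\delta\ge0$, $\int j_\delta=1$, $\operatorname{supp}j_\delta\subset\{|\mathbf r|\le\delta\}$, and let $\rho=j_\delta*\operatorname{dist}(\,\cdot\,,\operatorname{supp}v+\Gamma)$. Norms $\|\cdot\|_\infty$ are taken over $\Lambda$. For real $C_0,\tilde C_0$ put $$\kappa=\sqrt{\frac{C_0(E-E_-)}{C_0(E-E_-)+16(E_++\tilde C_0)(E_-+\tilde C_0)}},$$ $$\beta=\frac{\sqrt{2m_e}}{\hbar\,\||\nabla\rho|\|_\infty}\sqrt{\frac{C_0(E_+-E)(E-E_-)}{C_0(E-E_-)+16(E_++\tilde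 C_0)(E_-+\tilde C_0)}}$$ (with $\beta=0$ if $\nabla\rho=0$ on $\Lambda$), and suppose that $C_0,\tilde C_0$ satisfy, with $V_\Lambda^-=\max\{-V_\Lambda,0\}$, $$-\|V_\Lambda^-\|_\infty-\frac{\hbar^2\beta^2}{2m_e}\||\nabla\rho|\|_\infty^2+\tilde C_0>0,\qquad H_\Lambda-\frac{\hbar^2\beta^2}{2m_e}|\nabla\rho|^2+\tilde C_0\ \ge\ C_0>0$$ (the second in the sense of quadratic forms on $Q$). *Conclusion.* For every $\varepsilon\in\mathbb R$ the number $E+i\varepsilon$ is in the resolvent set of $H_\Lambda$ and $$\left\|v\,(H_\Lambda-E-i\varepsilon)^{-1}w\right\|\le C_1\|v\|_\infty\|w\|_\infty e^{-\beta r},\qquad C_1=K\,e^{2\beta\delta}\,C_0^{-1}\max\left\{\frac{E_++\tilde C_0}{(1-\kappa^2)(E_+-E)},\ \frac{E_-+\tilde C_0}{E-E_-}\right\}.$$ -/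

import Mathlib

open MeasureTheory
open scoped ENNReal ContDiff

noncomputable section

namespace MagneticSchrodinger

/-- `d`-dimensional Euclidean space. -/
abbrev Space (d : ℕ) := EuclideanSpace ℝ (Fin d)

/-- The data of `(1/2m)(p + eA)² + V` on an open region: `p = -iħ∇`, a vector potential `A` of
class `C¹` on the region and a real potential `V` in `L^∞` of the region. -/
structure System (d : ℕ) where
  hbar : ℝ
  hbar_pos : 0 < hbar
  mass : ℝ
  mass_pos : 0 < mass
  e : ℝ
  region : Set (Space d)
  isOpen_region : IsOpen region
  A : Space d → Space d
  contDiffOn_A : ContDiffOn ℝ 1 A region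
  V : Space d → ℝ
  memLp_V : MemLp V ∞ (volume.restrict region)

/-- Compactly supported smooth real functions on the region. -/
structure IsTest {d : ℕ} (U : Set (Space d)) (φ : Space d → ℝ) : Prop where
  contDiff : ContDiff ℝ ∞ φ
  hasCompactSupport : HasCompactSupport φ
  tsupport_subset : tsupport φ ⊆ U

namespace System

variable {d : ℕ} (S : System d)

/-- Lebesgue measure on the region. -/
abbrev μ : Measure (Space d) := volume.restrict S.region

/-- The Hilbert space `L²` of the region. -/
abbrev L2 := Lp ℂ 2 S.μ

/-- Multiplication by an `L^∞` function, as a bounded operator on `L²`. -/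
def mulOp (v : Lp ℂ ∞ S.μ) : S.L2 →L[ℂ] S.L2 :=
  (ContinuousLinearMap.mul ℂ ℂ).holderL S.μ ∞ 2 2 v

lemma memLp_complexV : MemLp (fun x => (S.V x : ℂ)) ∞ S.μ := S.memLp_V.ofReal

/-- The (formally transposed) momentum `(iħ∂ᵢ + eAᵢ)φ` of a test function. -/
def testMomentum (i : Fin d) (φ : Space d → ℝ) (x : Space d) : ℂ :=
  Complex.I * (S.hbar : ℂ) * ((fderiv ℝ φ x (EuclideanSpace.single i (1 : ℝ)) : ℝ) : ℂ)
    + ((S.e * S.A x i * φ x : ℝ) : ℂ)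

/-- `g = (pᵢ + eAᵢ)ψ` in the weak sense on the region. -/
def IsWeakMomentum (i : Fin d) (ψ g : S.L2) : Prop :=
  ∀ φ : Space d → ℝ, IsTest S.region φ →
    ∫ x in S.region, ψ x * S.testMomentum i φ x = ∫ x in S.region, g x * (φ x : ℂ)

lemma memLp_of_continuousOn_of_support {U : Set (Space d)} (hU : IsOpen U)
    {k : Set (Space d)} (hk : IsCompact k) (hkU : k ⊆ U) {f : Space d → ℂ}
    (hf : ContinuousOn f U) (h0 : ∀ x, x ∉ k → f x = 0) :
    MemLp f 2 (volume.restrict U) := by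
  obtain ⟨C, hC⟩ := hk.exists_bound_of_continuousOn (hf.mono hkU)
  have hfm : AEStronglyMeasurable f (volume.restrict U) :=
    hf.aestronglyMeasurable hU.measurableSet
  have hind : k.indicator f = f := by
    ext x
    by_cases hx : x ∈ k
    · simp [hx]
    · simp [hx, h0 x hx]
  rw [← hind, memLp_indicator_iff_restrict hk.measurableSet]
  have hfin : IsFiniteMeasure ((volume.restrict U).restrict k) := by
    constructor
    rw [Measure.restrict_apply_univ]
    exact (Measure.restrict_apply_le _ _).trans_lt hk.measure_lt_top
  refine MemLp.of_bound hfm.restrict C ?_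
  exact (ae_restrict_iff' hk.measurableSet).2 (Filter.Eventually.of_forall hC)

lemma memLp_testMomentum (i : Fin d) {φ : Space d → ℝ} (hφ : IsTest S.region φ) :
    MemLp (S.testMomentum i φ) 2 S.μ := by
  refine memLp_of_continuousOn_of_support S.isOpen_region hφ.hasCompactSupport
    hφ.tsupport_subset ?_ ?_
  · have h1 : Continuous fun x => fderiv ℝ φ x (EuclideanSpace.single i (1 : ℝ)) :=
      (hφ.contDiff.continuous_fderiv (by simp)).clm_apply continuous_const
    have h2 : ContinuousOn (fun x => S.A x i) S.region :=
      (EuclideanSpace.proj (𝕜 := ℝ) i).continuous.comp_continuousOn S.contDiffOn_A.continuousOn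
    have h3 : ContinuousOn φ S.region := hφ.contDiff.continuous.continuousOn
    unfold testMomentum
    refine ContinuousOn.add ?_ ?_
    · exact (continuous_const.mul (Complex.continuous_ofReal.comp h1)).continuousOn
    · exact Complex.continuous_ofReal.comp_continuousOn ((continuousOn_const.mul h2).mul h3)
  · intro x hx
    have h1 : fderiv ℝ φ x = 0 := by
      by_contra h
      exact hx (support_fderiv_subset ℝ h)
    have h2 : φ x = 0 := image_eq_zero_of_notMem_tsupport hx
    simp [testMomentum, h1, h2]

lemma memLp_test {φ : Space d → ℝ} (hφ : IsTest S.region φ) :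
    MemLp (fun x => (φ x : ℂ)) 2 S.μ := by
  refine memLp_of_continuousOn_of_support S.isOpen_region hφ.hasCompactSupport
    hφ.tsupport_subset ?_ ?_
  · exact (Complex.continuous_ofReal.comp hφ.contDiff.continuous).continuousOn
  · intro x hx
    simp [image_eq_zero_of_notMem_tsupport hx]

lemma integrable_mul (ψ : S.L2) {f : Space d → ℂ} (hf : MemLp f 2 S.μ) :
    Integrable (fun x => ψ x * f x) S.μ :=
  (Lp.memLp ψ).integrable_mul hf

/-- Test functions separate the elements of `L²`. -/
lemma eq_zero_of_test (g : S.L2)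
    (h : ∀ φ : Space d → ℝ, IsTest S.region φ → ∫ x in S.region, g x * (φ x : ℂ) = 0) :
    g = 0 := by
  have hloc : LocallyIntegrableOn (g : Space d → ℂ) S.region volume := by
    have hl : LocallyIntegrable (g : Space d → ℂ) S.μ :=
      (Lp.memLp g).locallyIntegrable (by norm_num)
    rw [locallyIntegrableOn_iff S.isOpen_region.isLocallyClosed]
    intro k hkU hk
    have := hl.integrableOn_isCompact hk
    rwa [IntegrableOn, Measure.restrict_restrict hk.measurableSet,
      Set.inter_eq_left.2 hkU] at this
  have key := S.isOpen_region.ae_eq_zero_of_integral_contDiff_smul_eq_zero hloc (by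
    intro φ h1 h2 h3
    have h4 := h φ ⟨h1, h2, h3⟩
    rw [← h4, ← setIntegral_eq_integral_of_forall_compl_eq_zero (s := S.region)]
    · refine integral_congr_ae (Filter.Eventually.of_forall fun x => ?_)
      simp [mul_comm]
    · intro x hx
      have : φ x = 0 := image_eq_zero_of_notMem_tsupport fun hx' => hx (h3 hx')
      simp [this])
  rw [Lp.eq_zero_iff_ae_eq_zero]
  exact (ae_restrict_iff' S.isOpen_region.measurableSet).2 key

/-- The graph of the maximal weak operator `pᵢ + eAᵢ` in `L²`. -/
def momentumGraph (i : Fin d) : Submodule ℂ (S.L2 × S.L2) where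
  carrier := {q | S.IsWeakMomentum i q.1 q.2}
  zero_mem' := by
    intro φ _
    have h : ∀ f : Space d → ℂ, ∫ x in S.region, (0 : S.L2) x * f x = 0 := fun f => by
      rw [integral_eq_zero_of_ae]
      filter_upwards [Lp.coeFn_zero ℂ 2 S.μ] with x hx
      simp only [hx, Pi.zero_apply, zero_mul]
    exact (h _).trans (h _).symm
  add_mem' := by
    intro p q hp hq φ hφ
    have hadd : ∀ (a b : S.L2) (f : Space d → ℂ), MemLp f 2 S.μ →
        ∫ x in S.region, (a + b) x * f x
          = (∫ x in S.region, a x * f x) + ∫ x in S.region, b x * f x := by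
      intro a b f hf
      rw [← integral_add (S.integrable_mul a hf) (S.integrable_mul b hf)]
      refine integral_congr_ae ?_
      filter_upwards [Lp.coeFn_add a b] with x hx
      simp only [hx, Pi.add_apply, add_mul]
    have h1 := hadd p.1 q.1 _ (S.memLp_testMomentum i hφ)
    have h2 := hadd p.2 q.2 _ (S.memLp_test hφ)
    exact h1.trans ((congrArg₂ (· + ·) (hp φ hφ) (hq φ hφ)).trans h2.symm)
  smul_mem' := by
    intro c p hp φ hφ
    have hsmul : ∀ (a : S.L2) (f : Space d → ℂ),
        ∫ x in S.region, (c • a) x * f x = c * ∫ x in S.region, a x * f x := by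
      intro a f
      rw [← integral_const_mul]
      refine integral_congr_ae ?_
      filter_upwards [Lp.coeFn_smul c a] with x hx
      simp [hx, mul_assoc]
    exact (hsmul p.1 _).trans ((congrArg (c * ·) (hp φ hφ)).trans (hsmul p.2 _).symm)

lemma momentumGraph_single_valued (i : Fin d) (q : S.L2 × S.L2) (hq : q ∈ S.momentumGraph i)
    (h0 : q.1 = 0) : q.2 = 0 := by
  refine S.eq_zero_of_test q.2 fun φ hφ => ?_
  rw [← hq φ hφ, h0, integral_eq_zero_of_ae]
  filter_upwards [Lp.coeFn_zero ℂ 2 S.μ] with x hx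
  simp only [hx, Pi.zero_apply, zero_mul]

/-- The maximal weak operator `pᵢ + eAᵢ` in `L²`. -/
def momentum (i : Fin d) : S.L2 →ₗ.[ℂ] S.L2 := (S.momentumGraph i).toLinearPMap

lemma momentum_graph (i : Fin d) : (S.momentum i).graph = S.momentumGraph i :=
  Submodule.toLinearPMap_graph_eq _ (S.momentumGraph_single_valued i)

/-- The magnetic Sobolev space: all `ψ ∈ L²` with weak `(p + eA)ψ ∈ L²`. -/
def sobolev : Submodule ℂ S.L2 := ⨅ i, (S.momentum i).domain

/-- `(pᵢ + eAᵢ)ψ` for `ψ` in the magnetic Sobolev space. -/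
def kin (i : Fin d) : S.sobolev →ₗ[ℂ] S.L2 :=
  (S.momentum i).toFun ∘ₗ Submodule.inclusion (iInf_le _ i)

/-- The sesquilinear form `(1/2m) ⟨(p + eA)φ, (p + eA)ψ⟩ + ⟨φ, Vψ⟩`. -/
def form (φ ψ : S.sobolev) : ℂ :=
  (1 / (2 * (S.mass : ℂ))) * ∑ i, inner ℂ (S.kin i φ) (S.kin i ψ)
    + inner ℂ (φ : S.L2) (S.mulOp (S.memLp_complexV.toLp _) (ψ : S.L2))

/-- `‖V⁻‖_∞` on the region, with `V⁻ = max(-V, 0)`. -/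
def normVneg : ℝ := (eLpNorm (fun x => max (-S.V x) 0) ∞ S.μ).toReal

end System

/-- A boundary condition for `(1/2m)(p + eA)² + V`, given by its form domain: a subspace of the
magnetic Sobolev space that contains the test functions, is complete in the form norm, and is
stable under multiplication by smooth bounded functions with bounded gradient that are invariant
under a group `periods` of translations.  Dirichlet, Neumann and mixed conditions have
`periods = ⊥`; (magnetically twisted) periodic conditions on a box have the period lattice. -/
structure BoundaryCondition {d : ℕ} (S : System d) where
  periods : AddSubgroup (Space d)
  formDomain : Submodule ℂ S.L2
  le_sobolev : formDomain ≤ S.sobolev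
  test_mem : ∀ (φ : Space d → ℝ) (hφ : IsTest S.region φ),
    (S.memLp_test hφ).toLp _ ∈ formDomain
  closed : IsClosed {q : S.L2 × (Fin d → S.L2) |
    ∃ h : q.1 ∈ formDomain, ∀ i, q.2 i = S.kin i ⟨q.1, le_sobolev h⟩}
  mul_mem : ∀ η : Space d → ℝ, ContDiff ℝ ∞ η →
    (∃ C : ℝ, ∀ x, |η x| ≤ C ∧ ‖fderiv ℝ η x‖ ≤ C) →
    (∀ γ ∈ periods, ∀ x, η (x + γ) = η x) →
    ∀ ψ ∈ formDomain, ∀ ψ' : S.L2, (∀ᵐ x ∂S.μ, ψ' x = (η x : ℂ) * ψ x) → ψ' ∈ formDomain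

namespace BoundaryCondition

variable {d : ℕ} {S : System d} (B : BoundaryCondition S)

/-- An element of the form domain, as an element of the magnetic Sobolev space. -/
def incl : B.formDomain →ₗ[ℂ] S.sobolev := Submodule.inclusion B.le_sobolev

lemma form_add_right (φ ψ χ : S.sobolev) : S.form φ (ψ + χ) = S.form φ ψ + S.form φ χ := by
  simp only [System.form, map_add, Submodule.coe_add, inner_add_right, Finset.sum_add_distrib]
  ring

lemma form_smul_right (c : ℂ) (φ ψ : S.sobolev) : S.form φ (c • ψ) = c * S.form φ ψ := by
  simp only [System.form, map_smul, Submodule.coe_smul, inner_smul_right, ← Finset.mul_sum]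
  ring

/-- The graph of the operator associated with the form on the form domain: `Hψ = f` means that
`ψ` is in the form domain and `form φ ψ = ⟨φ, f⟩` for all `φ` in the form domain. -/
def hamiltonianGraph : Submodule ℂ (S.L2 × S.L2) where
  carrier := {q | ∃ h : q.1 ∈ B.formDomain, ∀ φ : B.formDomain,
    S.form (B.incl φ) (B.incl ⟨q.1, h⟩) = inner ℂ (φ : S.L2) q.2}
  zero_mem' := by
    refine ⟨B.formDomain.zero_mem, fun φ => ?_⟩
    have h : (⟨(0 : S.L2 × S.L2).1, B.formDomain.zero_mem⟩ : B.formDomain) = (0 : ℂ) • 0 := by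
      simp
    rw [h, map_smul, form_smul_right]
    simp
  add_mem' := by
    rintro p q ⟨hp, hp'⟩ ⟨hq, hq'⟩
    refine ⟨B.formDomain.add_mem hp hq, fun φ => ?_⟩
    have h : (⟨(p + q).1, B.formDomain.add_mem hp hq⟩ : B.formDomain)
        = ⟨p.1, hp⟩ + ⟨q.1, hq⟩ := rfl
    rw [h, map_add, form_add_right, hp', hq', Prod.snd_add, inner_add_right]
  smul_mem' := by
    rintro c p ⟨hp, hp'⟩
    refine ⟨B.formDomain.smul_mem c hp, fun φ => ?_⟩
    have h : (⟨(c • p).1, B.formDomain.smul_mem c hp⟩ : B.formDomain) = c • ⟨p.1, hp⟩ := rfl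
    rw [h, map_smul, form_smul_right, hp', Prod.smul_snd, inner_smul_right]

lemma hamiltonianGraph_single_valued (q : S.L2 × S.L2) (hq : q ∈ B.hamiltonianGraph)
    (h0 : q.1 = 0) : q.2 = 0 := by
  obtain ⟨h, hq⟩ := hq
  have hz : ∀ φ : B.formDomain, inner ℂ (φ : S.L2) q.2 = 0 := by
    intro φ
    have h1 : (⟨q.1, h⟩ : B.formDomain) = (0 : ℂ) • 0 := by
      ext1; simp [h0]
    rw [← hq φ, h1, map_smul, form_smul_right, zero_mul]
  refine S.eq_zero_of_test q.2 fun φ hφ => ?_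
  rw [← hz ⟨_, B.test_mem φ hφ⟩, L2.inner_def]
  refine integral_congr_ae ?_
  filter_upwards [(S.memLp_test hφ).coeFn_toLp] with x hx
  simp [hx]

/-- The Hamiltonian `(1/2m)(p + eA)² + V` with the given boundary condition: the operator
associated with the closed form. -/
def hamiltonian : S.L2 →ₗ.[ℂ] S.L2 := B.hamiltonianGraph.toLinearPMap

lemma hamiltonian_graph : B.hamiltonian.graph = B.hamiltonianGraph :=
  Submodule.toLinearPMap_graph_eq _ B.hamiltonianGraph_single_valued

end BoundaryCondition

section Spectral

variable {H : Type*} [NormedAddCommGroup H] [NormedSpace ℂ H]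

/-- `R` is a bounded two-sided inverse of `T - z`. -/
def IsResolventAt (T : H →ₗ.[ℂ] H) (z : ℂ) (R : H →L[ℂ] H) : Prop :=
  (∀ y, ∃ h : R y ∈ T.domain, T ⟨R y, h⟩ - z • R y = y) ∧
    ∀ x : T.domain, R (T x - z • (x : H)) = x

/-- The resolvent set of an unbounded operator. -/
def resolventSet (T : H →ₗ.[ℂ] H) : Set ℂ := {z | ∃ R, IsResolventAt T z R}

open Classical in
/-- `(T - z)⁻¹` for `z` in the resolvent set (and `0` otherwise). -/
def resolvent (T : H →ₗ.[ℂ] H) (z : ℂ) : H →L[ℂ] H :=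
  if h : ∃ R, IsResolventAt T z R then h.choose else 0

/-- `(a, b)` is a gap in the spectrum of `T`: it contains no point of the spectrum, and there is
spectrum below it. -/
def IsSpectralGap (T : H →ₗ.[ℂ] H) (a b : ℝ) : Prop :=
  a < b ∧ (∀ x ∈ Set.Ioo a b, (x : ℂ) ∈ resolventSet T) ∧
    ∃ x : ℝ, x ≤ a ∧ (x : ℂ) ∉ resolventSet T

end Spectral

section Distance

variable {d : ℕ}

/-- The union of all translates of `s` by elements of `Γ`. -/
def periodize (Γ : AddSubgroup (Space d)) (s : Set (Space d)) : Set (Space d) :=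
  {z | ∃ x ∈ s, ∃ γ ∈ Γ, z = x + γ}

/-- The distance of two sets. -/
def setDist (s t : Set (Space d)) : ℝ := sInf {r | ∃ x ∈ s, ∃ y ∈ t, r = dist x y}

/-- `j` is a smooth probability density supported in the closed ball of radius `δ`. -/
structure IsMollifier (j : Space d → ℝ) (δ : ℝ) : Prop where
  pos : 0 < δ
  contDiff : ContDiff ℝ ∞ j
  nonneg : ∀ x, 0 ≤ j x
  tsupport_subset : tsupport j ⊆ Metric.closedBall 0 δ
  integral_eq_one : ∫ x, j x = 1

/-- The smoothed distance `j ∗ dist(·, Ω)`. -/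
def smoothDist (j : Space d → ℝ) (Ω : Set (Space d)) : Space d → ℝ :=
  convolution j (fun x => Metric.infDist x Ω) (ContinuousLinearMap.lsmul ℝ ℝ) volume

/-- `‖|∇ρ|‖_∞` on the region. -/
def gradNorm (S : System d) (ρ : Space d → ℝ) : ℝ := (eLpNorm (gradient ρ) ∞ S.μ).toReal

end Distance

/-- The parameter `κ`. -/
def kappa (C₀ Ct Em E Ep : ℝ) : ℝ :=
  √(C₀ * (E - Em) / (C₀ * (E - Em) + 16 * (Ep + Ct) * (Em + Ct)))

/-- The decay rate `β`, where `G = ‖|∇ρ|‖_∞`. -/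
def beta {d : ℕ} (S : System d) (G C₀ Ct Em E Ep : ℝ) : ℝ :=
  √(2 * S.mass) / (S.hbar * G) *
    √(C₀ * (Ep - E) * (E - Em) / (C₀ * (E - Em) + 16 * (Ep + Ct) * (Em + Ct)))

/-- The conditions on the two constants `C₀`, `Ct`, for given `ρ` and `β`:
`-‖V⁻‖_∞ - (ħ²β²/2m)‖|∇ρ|‖_∞² + Ct > 0`, and `H - (ħ²β²/2m)|∇ρ|² + Ct ≥ C₀ > 0` as
quadratic forms. -/
structure Admissible {d : ℕ} {S : System d} (B : BoundaryCondition S) (ρ : Space d → ℝ)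
    (β C₀ Ct : ℝ) : Prop where
  pos : 0 < C₀
  potential : 0 < -S.normVneg - S.hbar ^ 2 * β ^ 2 / (2 * S.mass) * gradNorm S ρ ^ 2 + Ct
  form_ge : ∀ ψ : B.formDomain,
    C₀ * ‖(ψ : S.L2)‖ ^ 2 ≤ (S.form (B.incl ψ) (B.incl ψ)).re
      - S.hbar ^ 2 * β ^ 2 / (2 * S.mass)
        * (∫ x in S.region, ‖gradient ρ x‖ ^ 2 * ‖(ψ : S.L2) x‖ ^ 2)
      + Ct * ‖(ψ : S.L2)‖ ^ 2

end MagneticSchrodinger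

end

noncomputable section

namespace MagneticSchrodinger

/-! ### Passing between the unbounded operator and its bounded resolvent. -/

section Resolvent

variable {H : Type*} [NormedAddCommGroup H] [NormedSpace ℂ H]

/-! Let `θ ≥ 0` be a bounded smooth weight with `|∇θ| ≤ |∇ρ|`. If `(H - E - iε)ψ₀ = F`, then `ψ =
e^{-βθ}ψ₀` solves `(A + iJ - iε)ψ = e^{-βθ}F`, where `A = H - E - (ħ²β²/2m)|∇θ|²` and `J`, a
first-order term, are both Hermitian (`form_exp_mul`). A bound on `ψ` by `e^{-βθ}F` yields the
decay, because `θ ≤ ρ ≤ δ` on `supp v` while `ρ ≥ r - δ` on `supp w`.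

To invert the conjugated operator, split `ψ = u + w` into its spectral parts above and below the gap
(`exists_gap_decomposition`) and test against `u - w` (`re_sub_add_ge`). In the real part the `ε`
term and the cross terms of `A` vanish. What remains is `A(u,u) - A(w,w)`, which is positive
definite by the gap, up to at most `2|J(u,w)|`. Estimating this cross term by the kinetic energies
of `u` and `w` alone would lose too much; instead these energies are compared with `A(u,u)` and
`-A(w,w)` through the shifted energy `A + E + Ct`, which dominates both `C₀` and the kinetic energy.
The choice of `κ` and `β` is exactly what lets half of `A(u,u) - A(w,w)` absorb the cross term
(`gap_estimate`); this half is the origin of `K = 2`.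

The spectral splitting uses only the bounded self-adjoint resolvent `R` at `E` and its continuous
functional calculus. The projection below the gap factors through `R`, so it maps into the operator
domain. The part above the gap lies only in the form domain, where its lower bound comes from a
bootstrap (`lower_bound`). The weight is a truncation of `ρ`, removed in the limit at the end. -/

lemma isUnit_of_mem_resolventSet {T : H →ₗ.[ℂ] H} {z c : ℂ} {R : H →L[ℂ] H}
    (hR : IsResolventAt T z R) (hc : z + c ∈ resolventSet T) : IsUnit (1 - c • R) := by
  obtain ⟨R', hR'⟩ := hc
  have h1 : ∀ y, R (y + c • R' y) = R' y := by
    intro y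
    obtain ⟨h, hy⟩ := hR'.1 y
    have : R (T ⟨R' y, h⟩ - z • R' y) = R' y := hR.2 ⟨R' y, h⟩
    rw [← this]
    congr 1
    nth_rw 1 [← hy]
    rw [this, add_smul]; abel
  have h2 : ∀ y, R' (y - c • R y) = R y := by
    intro y
    obtain ⟨h, hy⟩ := hR.1 y
    have : R' (T ⟨R y, h⟩ - (z + c) • R y) = R y := hR'.2 ⟨R y, h⟩
    rw [← this]
    congr 1
    nth_rw 1 [← hy]
    rw [this, add_smul]; abel
  refine ⟨⟨1 - c • R, 1 + c • R', ?_, ?_⟩, rfl⟩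
  · ext y
    change (y + c • R' y) - c • R (y + c • R' y) = y
    rw [h1, add_sub_cancel_right]
  · ext y
    change (y - c • R y) + c • R' (y - c • R y) = y
    rw [h2, sub_add_cancel]

/-- Since `T - (z + c) = (1 - cR)(T - z)`, invertibility of `T - (z + c)` and of `1 - cR` are
equivalent. This is how spectral information moves between `T` and `R`. -/
lemma mem_resolventSet_of_isUnit {T : H →ₗ.[ℂ] H} {z c : ℂ} {R : H →L[ℂ] H}
    (hR : IsResolventAt T z R) (hc : IsUnit (1 - c • R)) : z + c ∈ resolventSet T := by
  obtain ⟨u, hu⟩ := hc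
  have h1 : ∀ y, (u⁻¹.1 : H →L[ℂ] H) y - c • R ((u⁻¹.1 : H →L[ℂ] H) y) = y := by
    intro y
    have := DFunLike.congr_fun u.mul_inv y
    rw [hu] at this
    simpa using this
  have h2 : ∀ y, (u⁻¹.1 : H →L[ℂ] H) (y - c • R y) = y := by
    intro y
    have := DFunLike.congr_fun u.inv_mul y
    rw [hu] at this
    simpa using this
  refine ⟨R ∘L u⁻¹.1, fun y => ?_, fun x => ?_⟩
  · obtain ⟨h, hy⟩ := hR.1 ((u⁻¹.1 : H →L[ℂ] H) y)
    refine ⟨h, ?_⟩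
    have h3 := h1 y
    nth_rw 1 [← hy] at h3
    refine Eq.trans ?_ h3
    simp only [ContinuousLinearMap.comp_apply, add_smul]
    abel
  · have h3 := hR.2 x
    have h4 := h2 (T x - z • (x : H))
    rw [h3] at h4
    simp only [ContinuousLinearMap.comp_apply]
    rw [add_smul, ← sub_sub, h4, h3]

lemma isResolventAt_resolvent {T : H →ₗ.[ℂ] H} {z : ℂ} (hz : z ∈ resolventSet T) :
    IsResolventAt T z (resolvent T z) := by
  have h : ∃ R, IsResolventAt T z R := hz
  unfold resolvent
  rw [dif_pos h]
  exact h.choose_spec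

lemma isUnit_one_sub_smul_iff {R : H →L[ℂ] H} {l : ℝ} (hl : l ≠ 0) :
    IsUnit (1 - (l : ℂ) • R) ↔ l⁻¹ ∉ spectrum ℝ R := by
  have hl' : (l : ℂ) ≠ 0 := by exact_mod_cast hl
  rw [spectrum.notMem_iff]
  have : algebraMap ℝ (H →L[ℂ] H) l⁻¹ - R = (Units.mk0 (l : ℂ) hl')⁻¹ • (1 - (l : ℂ) • R) := by
    rw [Units.smul_def, Units.val_inv_eq_inv_val, Units.val_mk0, smul_sub, smul_smul,
      inv_mul_cancel₀ hl', one_smul, Algebra.algebraMap_eq_smul_one]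
    congr 1
    ext x
    simp only [smul_apply, one_apply_eq_self]
    rw [← Complex.coe_smul, Complex.ofReal_inv]
  rw [this, isUnit_smul_iff]

end Resolvent

/-! ### Functional calculus for a self-adjoint resolvent. -/

section SelfAdjoint

variable {H : Type*} [NormedAddCommGroup H] [InnerProductSpace ℂ H] [CompleteSpace H]

/-- The spectrum of `R` is real, so it misses `1 / (il)`. This puts the whole vertical line through
a point of the gap into the resolvent set. -/
lemma isUnit_one_sub_mul_I_smul {R : H →L[ℂ] H} (hR : IsSelfAdjoint R) (l : ℝ) :
    IsUnit (1 - ((l : ℂ) * Complex.I) • R) := by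
  rcases eq_or_ne l 0 with rfl | hl
  · simp
  have hl' : (l : ℂ) * Complex.I ≠ 0 := by simp [hl]
  have h : ((l : ℂ) * Complex.I)⁻¹ ∉ spectrum ℂ R := by
    intro hm
    have := congrArg Complex.im (hR.mem_spectrum_eq_re hm)
    simp [hl] at this
  rw [spectrum.notMem_iff] at h
  have : algebraMap ℂ (H →L[ℂ] H) ((l : ℂ) * Complex.I)⁻¹ - R
      = (Units.mk0 _ hl')⁻¹ • (1 - ((l : ℂ) * Complex.I) • R) := by
    rw [Units.smul_def, Units.val_inv_eq_inv_val, Units.val_mk0, smul_sub, smul_smul,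
      inv_mul_cancel₀ hl', one_smul, Algebra.algebraMap_eq_smul_one]
  rwa [this, isUnit_smul_iff] at h

lemma cfc_linear_add_sq {R : H →L[ℂ] H} (hR : IsSelfAdjoint R) (a c : ℝ) :
    cfc (fun s : ℝ => a * s + c * (s * s)) R = a • R + c • (R * R) := by
  rw [cfc_add .., cfc_const_mul .., cfc_const_mul .., cfc_mul .., cfc_id' ℝ R]

lemma re_inner_linear_add_sq {R : H →L[ℂ] H} (hR : IsSelfAdjoint R) (a c : ℝ) (v : H) :
    (inner ℂ ((a • R + c • (R * R)) v) v).re = a * (inner ℂ (R v) v).re + c * ‖R v‖ ^ 2 := by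
  have hs : inner ℂ (R (R v)) v = inner ℂ (R v) (R v) := hR.isSymmetric (R v) v
  have h1 : (a • R + c • (R * R)) v = (a : ℂ) • R v + (c : ℂ) • R (R v) := by
    simp
  rw [h1, inner_add_left, inner_smul_left, inner_smul_left, hs, inner_self_eq_norm_sq_to_K]
  simp only [Complex.conj_ofReal, Complex.add_re, Complex.re_ofReal_mul]
  norm_cast

/-- Positivity of `(aR + cR²)` on the range of `f(R)`, read off from the spectrum. -/
lemma inner_add_norm_sq_nonneg {R : H →L[ℂ] H} (hR : IsSelfAdjoint R) {f : ℝ → ℝ}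
    (hf : Continuous f) (a c : ℝ)
    (h : ∀ s ∈ spectrum ℝ R, 0 ≤ (a * s + c * (s * s)) * f s ^ 2) (v : H) :
    0 ≤ a * (inner ℂ (R (cfc f R v)) (cfc f R v)).re + c * ‖R (cfc f R v)‖ ^ 2 := by
  have h1 : 0 ≤ cfc (fun s => f s * ((a * s + c * (s * s)) * f s)) R :=
    cfc_nonneg fun s hs => by
      have := h s hs
      nlinarith
  have h2 : cfc (fun s => f s * ((a * s + c * (s * s)) * f s)) R
      = cfc f R * ((a • R + c • (R * R)) * cfc f R) := by
    rw [cfc_mul _ _ R (by fun_prop) (by fun_prop), cfc_mul _ _ R (by fun_prop) (by fun_prop),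
      cfc_linear_add_sq hR]
  have hfs : IsSelfAdjoint (cfc f R) := cfc_predicate f R
  rw [h2, ContinuousLinearMap.nonneg_iff_isPositive] at h1
  have h3 := h1.re_inner_nonneg_left v
  have h4 : inner ℂ ((cfc f R * ((a • R + c • (R * R)) * cfc f R)) v) v
      = inner ℂ ((a • R + c • (R * R)) (cfc f R v)) (cfc f R v) :=
    hfs.isSymmetric ((a • R + c • (R * R)) (cfc f R v)) v
  rw [h4] at h3
  rw [← re_inner_linear_add_sq hR]
  exact h3

/-- A continuous function of `R` is a nonnegative operator exactly when it is nonnegative on the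
spectrum, so quadratic-form inequalities become inequalities for spectral values. -/
lemma spectrum_of_inner_add_norm_sq_nonneg {R : H →L[ℂ] H} (hR : IsSelfAdjoint R) {a c : ℝ}
    (h : ∀ v, 0 ≤ a * (inner ℂ (R v) v).re + c * ‖R v‖ ^ 2) {s : ℝ} (hs : s ∈ spectrum ℝ R) :
    0 ≤ a * s + c * (s * s) := by
  have h1 : 0 ≤ cfc (fun s : ℝ => a * s + c * (s * s)) R := by
    have hsa : IsSelfAdjoint (cfc (fun s : ℝ => a * s + c * (s * s)) R) := cfc_predicate _ R
    rw [ContinuousLinearMap.nonneg_iff_isPositive, ContinuousLinearMap.isPositive_def']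
    refine ⟨hsa, fun v => ?_⟩
    rw [cfc_linear_add_sq hR, ContinuousLinearMap.reApplyInnerSelf_apply]
    exact (h v).trans_eq (re_inner_linear_add_sq hR a c v).symm
  exact (cfc_nonneg_iff _ R).1 h1 s hs

/-- Equal to `1 / s` for `s ≤ -1 / b` and to `0` for `s ≥ 0`. -/
def negInv (b s : ℝ) : ℝ := -b * max 0 (min 1 (-b * s)) / max 1 (-b * s)

lemma continuous_negInv (b : ℝ) : Continuous (negInv b) := by
  unfold negInv
  refine Continuous.div (by fun_prop) (by fun_prop) fun s => ?_
  have : (1 : ℝ) ≤ max 1 (-b * s) := le_max_left _ _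
  linarith

lemma negInv_of_nonneg {b s : ℝ} (hb : 0 < b) (hs : 0 ≤ s) : negInv b s = 0 := by
  have : min 1 (-b * s) ≤ 0 := (min_le_right _ _).trans (by nlinarith)
  rw [negInv, max_eq_left this]
  simp

lemma mul_negInv_of_le {b s : ℝ} (hb : 0 < b) (hs : b * s ≤ -1) : s * negInv b s = 1 := by
  have h1 : min 1 (-b * s) = 1 := min_eq_left (by linarith)
  have h2 : max 1 (-b * s) = -b * s := max_eq_right (by linarith)
  have h3 : s ≠ 0 := by rintro rfl; linarith
  rw [negInv, h1, h2]
  field_simp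
  simp

/-- Splitting off the negative spectral part of a self-adjoint operator with a spectral gap
below `0`; the negative part factors through the operator. -/
lemma exists_negative_part {R : H →L[ℂ] H} (hR : IsSelfAdjoint R) {x y b : ℝ} (hb : 0 < b)
    (hσ : ∀ s ∈ spectrum ℝ R, (0 ≤ s ∧ y * s ≤ 1) ∨ (b * s ≤ -1 ∧ -1 ≤ x * s)) :
    ∃ G : H →L[ℂ] H, (∀ v, G (R v) = R (G v)) ∧
      (∀ v, R (G (R (G v))) = R (G v)) ∧
      (∀ v w, inner ℂ (R (G v)) w = inner ℂ v (R (G w))) ∧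
      (∀ v, x * ‖R (G v)‖ ^ 2 ≤ -(inner ℂ (R (G v)) (G v)).re) ∧
      ∀ v, y * ‖R (v - R (G v))‖ ^ 2
        ≤ (inner ℂ (R (v - R (G v))) (v - R (G v))).re := by
  have hc := continuous_negInv b
  have hG : cfc (negInv b) R * R = R * cfc (negInv b) R := by
    have := cfc_commute_cfc (negInv b) (fun s => s) R
    rw [cfc_id' ℝ R] at this
    exact this
  have hP : cfc (fun s => s * negInv b s) R = R * cfc (negInv b) R := by
    rw [cfc_mul _ _ R (by fun_prop) (by fun_prop), cfc_id' ℝ R]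
  -- On the spectrum `s * negInv b s` takes only the values `0` and `1`: the gap `(-1/b, 0)` makes
  -- the negative spectral projection a continuous function of `R`.
  have hPP : R * cfc (negInv b) R * (R * cfc (negInv b) R) = R * cfc (negInv b) R := by
    rw [← hP, ← cfc_mul _ _ R (by fun_prop) (by fun_prop)]
    refine cfc_congr fun s hs => ?_
    rcases hσ s hs with h | h
    · simp [negInv_of_nonneg hb h.1]
    · simp [mul_negInv_of_le hb h.1]
  have hPs : IsSelfAdjoint (R * cfc (negInv b) R) := hP ▸ cfc_predicate _ R
  refine ⟨cfc (negInv b) R, fun v => DFunLike.congr_fun hG v, fun v => DFunLike.congr_fun hPP v,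
    fun v w => hPs.isSymmetric v w, fun v => ?_, fun v => ?_⟩
  · have := inner_add_norm_sq_nonneg hR hc (-1) (-x) (fun s hs => ?_) v
    · linarith
    · rcases hσ s hs with h | h
      · simp [negInv_of_nonneg hb h.1]
      · refine mul_nonneg ?_ (sq_nonneg _)
        have : s ≤ 0 := by nlinarith
        nlinarith
  · have := inner_add_norm_sq_nonneg hR (f := fun s => 1 - s * negInv b s) (by fun_prop) 1 (-y)
      (fun s hs => ?_) v
    · have h1 : cfc (fun s => 1 - s * negInv b s) R v = v - R (cfc (negInv b) R v) := by
        rw [cfc_sub _ _ R (by fun_prop) (by fun_prop), cfc_const_one ℝ R, hP]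
        rfl
      rw [h1] at this
      linarith
    · rcases hσ s hs with h | h
      · refine mul_nonneg ?_ (sq_nonneg _)
        nlinarith
      · simp [mul_negInv_of_le hb h.1]

end SelfAdjoint

/-! ### Hermitian forms and their bounded inverses. -/

section HermitianForm

/-- A Hermitian sesquilinear form, linear in the second variable. -/
structure IsHermitianForm {M : Type*} [AddCommGroup M] [Module ℂ M] (q : M → M → ℂ) : Prop where
  add_right : ∀ φ ψ χ, q φ (ψ + χ) = q φ ψ + q φ χ
  smul_right : ∀ (c : ℂ) φ ψ, q φ (c • ψ) = c * q φ ψ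
  conj_symm : ∀ φ ψ, (starRingEnd ℂ) (q ψ φ) = q φ ψ

namespace IsHermitianForm

section Algebra

variable {M : Type*} [AddCommGroup M] [Module ℂ M] {p q : M → M → ℂ}

lemma sub_right (hq : IsHermitianForm q) (φ ψ χ : M) : q φ (ψ - χ) = q φ ψ - q φ χ := by
  have h : ψ - χ = ψ + (-1 : ℂ) • χ := by rw [neg_one_smul, sub_eq_add_neg]
  rw [h, hq.add_right, hq.smul_right]
  ring

lemma sub_left (hq : IsHermitianForm q) (φ ψ χ : M) : q (φ - ψ) χ = q φ χ - q ψ χ := by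
  rw [← hq.conj_symm, hq.sub_right, map_sub, hq.conj_symm, hq.conj_symm]

lemma smul_left (hq : IsHermitianForm q) (c : ℂ) (φ ψ : M) :
    q (c • φ) ψ = (starRingEnd ℂ) c * q φ ψ := by
  rw [← hq.conj_symm, hq.smul_right, map_mul, hq.conj_symm]

lemma add (hp : IsHermitianForm p) (hq : IsHermitianForm q) :
    IsHermitianForm fun φ ψ => p φ ψ + q φ ψ where
  add_right φ ψ χ := by rw [hp.add_right, hq.add_right]; ring
  smul_right c φ ψ := by rw [hp.smul_right, hq.smul_right]; ring
  conj_symm φ ψ := by rw [map_add, hp.conj_symm, hq.conj_symm]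

lemma const_mul (hq : IsHermitianForm q) (c : ℝ) :
    IsHermitianForm fun φ ψ => (c : ℂ) * q φ ψ where
  add_right φ ψ χ := by rw [hq.add_right]; ring
  smul_right c φ ψ := by rw [hq.smul_right]; ring
  conj_symm φ ψ := by rw [map_mul, hq.conj_symm, Complex.conj_ofReal]

lemma sub (hp : IsHermitianForm p) (hq : IsHermitianForm q) :
    IsHermitianForm fun φ ψ => p φ ψ - q φ ψ where
  add_right φ ψ χ := by rw [hp.add_right, hq.add_right]; ring
  smul_right c φ ψ := by rw [hp.smul_right, hq.smul_right]; ring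
  conj_symm φ ψ := by rw [map_sub, hp.conj_symm, hq.conj_symm]

lemma sum {ι : Type*} [Fintype ι] {q : ι → M → M → ℂ} (hq : ∀ i, IsHermitianForm (q i)) :
    IsHermitianForm fun φ ψ => ∑ i, q i φ ψ where
  add_right φ ψ χ := by simp only [(hq _).add_right, Finset.sum_add_distrib]
  smul_right c φ ψ := by simp only [(hq _).smul_right, Finset.mul_sum]
  conj_symm φ ψ := by simp only [map_sum, (hq _).conj_symm]

lemma comp (hq : IsHermitianForm q) {N : Type*} [AddCommGroup N] [Module ℂ N] (F : N →ₗ[ℂ] M) :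
    IsHermitianForm fun φ ψ => q (F φ) (F ψ) where
  add_right φ ψ χ := by rw [map_add, hq.add_right]
  smul_right c φ ψ := by rw [map_smul, hq.smul_right]
  conj_symm φ ψ := hq.conj_symm _ _

variable {H : Type*} [NormedAddCommGroup H] [InnerProductSpace ℂ H]

lemma inner_add_inner (F G : M →ₗ[ℂ] H) :
    IsHermitianForm fun φ ψ => inner ℂ (F φ) (G ψ) + inner ℂ (G φ) (F ψ) where
  add_right φ ψ χ := by simp only [map_add, inner_add_right]; ring
  smul_right c φ ψ := by simp only [map_smul, inner_smul_right]; ring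
  conj_symm φ ψ := by simp only [map_add, inner_conj_symm]; ring

lemma inner_symmetric {V : H →L[ℂ] H} (hV : ∀ f g, inner ℂ (V f) g = inner ℂ f (V g)) :
    IsHermitianForm fun f g : H => inner ℂ f (V g) where
  add_right φ ψ χ := by simp only [map_add, inner_add_right]
  smul_right c φ ψ := by simp only [map_smul, inner_smul_right]
  conj_symm φ ψ := by rw [inner_conj_symm, hV]

lemma inner : IsHermitianForm fun f g : H => inner ℂ f g :=
  inner_symmetric (V := ContinuousLinearMap.id ℂ H) fun _ _ => rfl

lemma self_eq_re (hq : IsHermitianForm q) (φ : M) : q φ φ = ((q φ φ).re : ℂ) :=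
  (Complex.conj_eq_iff_re.1 (hq.conj_symm φ φ)).symm

/-- Testing `A + iJ - iε` on `u + w` against `u - w`. -/
lemma re_sub_add_ge {A J : M → M → ℂ} (hA : IsHermitianForm A) (hJ : IsHermitianForm J)
    (F : M →ₗ[ℂ] H) (ε : ℝ) {u w : M} (h0 : Inner.inner ℂ (F u) (F w) = (0 : ℂ)) :
    (A u u).re - (A w w).re - 2 * ‖J u w‖ ≤
      (A (u - w) (u + w) + Complex.I * J (u - w) (u + w)
        - (ε : ℂ) * Complex.I * Inner.inner ℂ (F (u - w)) (F (u + w))).re := by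
  have h0' : Inner.inner ℂ (F w) (F u) = (0 : ℂ) := by rw [← inner_conj_symm, h0, map_zero]
  have hA' : (A w u).re = (A u w).re := by rw [← hA.conj_symm, Complex.conj_re]
  have hJ' : (J w u).im = -(J u w).im := by rw [← hJ.conj_symm, Complex.conj_im]
  have hu : (J u u).im = 0 := by rw [hJ.self_eq_re]; exact Complex.ofReal_im _
  have hw : (J w w).im = 0 := by rw [hJ.self_eq_re]; exact Complex.ofReal_im _
  have hm : |(J u w).im| ≤ ‖J u w‖ := Complex.abs_im_le_norm _
  have hm' := abs_le.1 hm
  rw [hA.add_right, hA.sub_left, hA.sub_left, hJ.add_right, hJ.sub_left, hJ.sub_left, map_sub,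
    map_add, inner_add_right, inner_sub_left, inner_sub_left, h0, h0',
    inner_self_eq_norm_sq_to_K, inner_self_eq_norm_sq_to_K]
  -- By orthogonality the `ε` term is `iε` times the real number `‖F u‖² - ‖F w‖²`, so its real part
  -- is zero; this makes the estimate uniform in `ε`.
  have h1 : ((ε : ℂ) * Complex.I * ((((‖F u‖ : ℝ) : ℂ) ^ 2 - 0)
      + (0 - ((‖F w‖ : ℝ) : ℂ) ^ 2))).re = 0 := by
    rw [show (ε : ℂ) * Complex.I * ((((‖F u‖ : ℝ) : ℂ) ^ 2 - 0) + (0 - ((‖F w‖ : ℝ) : ℂ) ^ 2))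
      = ((ε * (‖F u‖ ^ 2 - ‖F w‖ ^ 2) : ℝ) : ℂ) * Complex.I by push_cast; ring]
    rw [Complex.re_ofReal_mul, Complex.I_re, mul_zero]
  rw [Complex.sub_re, RCLike.ofReal_eq_complex_ofReal, h1]
  simp only [Complex.add_re, Complex.sub_re, Complex.mul_re, Complex.I_re, Complex.I_im,
    Complex.add_im, Complex.sub_im, hA', hJ', hu, hw]
  linarith

end Algebra

variable {H : Type*} [NormedAddCommGroup H] [InnerProductSpace ℂ H] {Q : Submodule ℂ H}
  {q : Q → Q → ℂ}

/-- The inverse of a Hermitian form is symmetric. -/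
lemma inverse_symmetric (hq : IsHermitianForm q) {R : H →L[ℂ] H}
    (hR : ∀ f, ∃ h : R f ∈ Q, ∀ φ : Q, q φ ⟨R f, h⟩ = Inner.inner ℂ (φ : H) f) (f g : H) :
    Inner.inner ℂ (R f) g = Inner.inner ℂ f (R g) := by
  obtain ⟨hf, hf'⟩ := hR f
  obtain ⟨hg, hg'⟩ := hR g
  rw [← hg' ⟨R f, hf⟩, ← hq.conj_symm, hf' ⟨R g, hg⟩, inner_conj_symm]

/-- Expand `q` at `u - yRu`, where `q(u, Ru) = ‖u‖²` and `q(Ru, Ru) = ⟨Ru, u⟩`, and use `y²‖Ru‖² ≤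
y⟨Ru, u⟩ ≤ ‖u‖²`. A lower bound `-c` on the invariant set thereby improves to `y - c`. -/
lemma lower_bound_step (hq : IsHermitianForm q) {R : H →L[ℂ] H}
    (hR : ∀ f, ∃ h : R f ∈ Q, ∀ φ : Q, q φ ⟨R f, h⟩ = Inner.inner ℂ (φ : H) f)
    {N : Set H} {y : ℝ} (hy : 0 < y) (hN : ∀ u ∈ N, u - (y : ℂ) • R u ∈ N)
    (hN' : ∀ u ∈ N, y * ‖R u‖ ^ 2 ≤ (Inner.inner ℂ (R u) u).re) {c : ℝ} (hc : 0 ≤ c)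
    (h : ∀ u : Q, (u : H) ∈ N → -c * ‖(u : H)‖ ^ 2 ≤ (q u u).re) (u : Q) (hu : (u : H) ∈ N) :
    (y - c) * ‖(u : H)‖ ^ 2 ≤ (q u u).re := by
  obtain ⟨hRu, hRu'⟩ := hR u
  set t : Q := ⟨R u, hRu⟩ with ht
  have h1 := h (u - (y : ℂ) • t) (hN u hu)
  have h2 := hN' u hu
  have e1 : q u t = ((‖(u : H)‖ ^ 2 : ℝ) : ℂ) := by
    rw [hRu', inner_self_eq_norm_sq_to_K]; norm_cast
  have e2 : q t u = ((‖(u : H)‖ ^ 2 : ℝ) : ℂ) := by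
    rw [← hq.conj_symm, e1, Complex.conj_ofReal]
  have e3 : q t t = Inner.inner ℂ (R u) (u : H) := hRu' t
  have e4 : (q (u - (y : ℂ) • t) (u - (y : ℂ) • t)).re
      = (q u u).re - 2 * y * ‖(u : H)‖ ^ 2 + y ^ 2 * (Inner.inner ℂ (R u) (u : H)).re := by
    rw [hq.sub_right, hq.sub_left, hq.sub_left, hq.smul_right, hq.smul_right, hq.smul_left,
      hq.smul_left, e1, e2, e3, Complex.conj_ofReal]
    simp only [Complex.sub_re, Complex.re_ofReal_mul, Complex.ofReal_re]
    ring
  have e5 : ‖((u - (y : ℂ) • t : Q) : H)‖ ^ 2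
      = ‖(u : H)‖ ^ 2 - 2 * y * (Inner.inner ℂ (R u) (u : H)).re + y ^ 2 * ‖R u‖ ^ 2 := by
    have : ((u - (y : ℂ) • t : Q) : H) = (u : H) - (y : ℂ) • R u := rfl
    rw [this, @norm_sub_sq ℂ, norm_smul, inner_smul_right]
    have h3 : RCLike.re ((y : ℂ) * Inner.inner ℂ (u : H) (R u))
        = y * (Inner.inner ℂ (R u) (u : H)).re := by
      have h4 := inner_re_symm (𝕜 := ℂ) (u : H) (R u)
      exact (Complex.re_ofReal_mul _ _).trans (congrArg (y * ·) h4)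
    rw [h3, Complex.norm_real, Real.norm_of_nonneg hy.le]
    ring
  rw [e4, e5] at h1
  have h3 : (Inner.inner ℂ (R u) (u : H)).re ≤ ‖R u‖ * ‖(u : H)‖ :=
    (Complex.re_le_norm _).trans (norm_inner_le_norm _ _)
  have h4 : y * ‖R u‖ ≤ ‖(u : H)‖ := by
    rcases (norm_nonneg (R u)).eq_or_lt with h0 | h0
    · rw [← h0, mul_zero]; exact norm_nonneg _
    · by_contra! hlt
      nlinarith
  have h5 : y * (Inner.inner ℂ (R u) (u : H)).re ≤ ‖(u : H)‖ ^ 2 := by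
    nlinarith [norm_nonneg (u : H)]
  have h6 : 0 ≤ (Inner.inner ℂ (R u) (u : H)).re := le_trans (by positivity) h2
  have h7 : 0 ≤ c * (y * (Inner.inner ℂ (R u) (u : H)).re) := by positivity
  have h8 : 0 ≤ c * y * ((Inner.inner ℂ (R u) (u : H)).re - y * ‖R u‖ ^ 2) :=
    mul_nonneg (by positivity) (by linarith)
  have h9 : 0 ≤ y * (‖(u : H)‖ ^ 2 - y * (Inner.inner ℂ (R u) (u : H)).re) :=
    mul_nonneg hy.le (by linarith)
  nlinarith

/-- A Hermitian form bounded below whose inverse satisfies `yR² ≤ R` on an invariant set is at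
least `y` there; no closedness of the form is needed. -/
lemma lower_bound (hq : IsHermitianForm q) {R : H →L[ℂ] H}
    (hR : ∀ f, ∃ h : R f ∈ Q, ∀ φ : Q, q φ ⟨R f, h⟩ = Inner.inner ℂ (φ : H) f)
    {N : Set H} {y : ℝ} (hy : 0 < y) (hN : ∀ u ∈ N, u - (y : ℂ) • R u ∈ N)
    (hN' : ∀ u ∈ N, y * ‖R u‖ ^ 2 ≤ (Inner.inner ℂ (R u) u).re) {b : ℝ}
    (h : ∀ u : Q, -b * ‖(u : H)‖ ^ 2 ≤ (q u u).re) (u : Q) (hu : (u : H) ∈ N) :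
    y * ‖(u : H)‖ ^ 2 ≤ (q u u).re := by
  -- Each step lowers the deficit by `y`, truncated at `0` because the step needs `c ≥ 0`. Once `n ≥
  -- b / y` the deficit is `0`, and one more step gives the bound `y`.
  have key : ∀ n : ℕ, ∀ u : Q, (u : H) ∈ N →
      -(max 0 (b - n * y)) * ‖(u : H)‖ ^ 2 ≤ (q u u).re := by
    intro n
    induction n with
    | zero =>
      intro u _
      refine le_trans (mul_le_mul_of_nonneg_right ?_ (sq_nonneg _)) (h u)
      have := le_max_right 0 (b - (0 : ℕ) * y)
      push_cast at this ⊢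
      linarith
    | succ n ih =>
      intro u hu
      refine le_trans (mul_le_mul_of_nonneg_right ?_ (sq_nonneg _))
        (hq.lower_bound_step hR hy hN hN' (le_max_left _ _) ih u hu)
      have h1 := le_max_right 0 (b - (n + 1 : ℕ) * y)
      have h2 := le_max_left 0 (b - (n + 1 : ℕ) * y)
      push_cast at h1 h2 ⊢
      rcases max_choice 0 (b - n * y) with h3 | h3 <;> rw [h3] <;> linarith
  obtain ⟨n, hn⟩ := exists_nat_ge (b / y)
  have h0 : max 0 (b - n * y) = 0 := max_eq_left (by rw [div_le_iff₀ hy] at hn; linarith)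
  have := hq.lower_bound_step hR hy hN hN' le_rfl (fun u hu => by simpa [h0] using key n u hu) u hu
  simpa using this

end IsHermitianForm

end HermitianForm

namespace System

variable {d : ℕ} (S : System d)

/-! ### Multiplication by bounded real functions on `L²`. -/

section Multiplication

lemma mulOp_ae {v : Space d → ℂ} (hv : MemLp v ∞ S.μ) (ψ : S.L2) :
    ∀ᵐ x ∂S.μ, S.mulOp (hv.toLp v) ψ x = v x * ψ x := by
  filter_upwards [(ContinuousLinearMap.mul ℂ ℂ).coeFn_holder (r := 2) (hv.toLp v) ψ,
    hv.coeFn_toLp] with x h1 h2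
  refine Eq.trans h1 ?_
  rw [h2]
  rfl

lemma mulOp_eq_iff {v : Space d → ℂ} (hv : MemLp v ∞ S.μ) (ψ χ : S.L2) :
    S.mulOp (hv.toLp v) ψ = χ ↔ ∀ᵐ x ∂S.μ, v x * ψ x = χ x := by
  constructor
  · rintro rfl
    filter_upwards [S.mulOp_ae hv ψ] with x hx
    exact hx.symm
  · intro h
    refine Lp.ext ?_
    filter_upwards [S.mulOp_ae hv ψ, h] with x h1 h2
    rw [h1, h2]

lemma norm_mulOp_apply_le {v : Space d → ℂ} (hv : MemLp v ∞ S.μ) {ψ χ : S.L2} {C : ℝ}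
    (h : ∀ᵐ x ∂S.μ, ‖v x * ψ x‖ ≤ C * ‖χ x‖) : ‖S.mulOp (hv.toLp v) ψ‖ ≤ C * ‖χ‖ := by
  refine Lp.norm_le_mul_norm_of_ae_le_mul ?_
  filter_upwards [S.mulOp_ae hv ψ, h] with x h1 h2
  rw [h1]
  exact h2

lemma ae_norm_le_eLpNorm {F : Type*} [NormedAddCommGroup F] {v : Space d → F}
    (hv : MemLp v ∞ S.μ) : ∀ᵐ x ∂S.μ, ‖v x‖ ≤ (eLpNorm v ∞ S.μ).toReal := by
  have h := hv.2.ne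
  rw [eLpNorm_exponent_top] at h ⊢
  filter_upwards [ae_le_eLpNormEssSup (f := v) (μ := S.μ)] with x hx
  have := ENNReal.toReal_mono h hx
  simpa using this

/-- Multiplication by a real `L^∞` function. -/
def mulReal (f : Space d → ℝ) (hf : MemLp f ∞ S.μ) : S.L2 →L[ℂ] S.L2 :=
  S.mulOp (hf.ofReal.toLp fun x => (f x : ℂ))

variable {S}
variable {f g : Space d → ℝ} {hf : MemLp f ∞ S.μ} {hg : MemLp g ∞ S.μ}

lemma mulReal_ae (ψ : S.L2) : ∀ᵐ x ∂S.μ, S.mulReal f hf ψ x = (f x : ℂ) * ψ x :=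
  S.mulOp_ae hf.ofReal ψ

lemma mulReal_comm (ψ : S.L2) :
    S.mulReal f hf (S.mulReal g hg ψ) = S.mulReal g hg (S.mulReal f hf ψ) := by
  refine Lp.ext ?_
  filter_upwards [S.mulReal_ae (hf := hf) (S.mulReal g hg ψ), S.mulReal_ae (hf := hg) ψ,
    S.mulReal_ae (hf := hg) (S.mulReal f hf ψ), S.mulReal_ae (hf := hf) ψ] with x h1 h2 h3 h4
  rw [h1, h2, h3, h4]
  ring

lemma mulReal_symmetric (φ ψ : S.L2) :
    inner ℂ (S.mulReal f hf φ) ψ = inner ℂ φ (S.mulReal f hf ψ) := by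
  rw [L2.inner_def, L2.inner_def]
  refine integral_congr_ae ?_
  filter_upwards [S.mulReal_ae (hf := hf) φ, S.mulReal_ae (hf := hf) ψ] with x h1 h2
  simp only [h1, h2, RCLike.inner_apply, map_mul, Complex.conj_ofReal]
  ring

lemma integrable_norm_sq (ψ : S.L2) : Integrable (fun x => ‖ψ x‖ ^ 2) S.μ :=
  (memLp_two_iff_integrable_sq_norm (Lp.memLp ψ).1).1 (Lp.memLp ψ)

lemma integrable_mul_norm_sq {f : Space d → ℝ} (hf : MemLp f ∞ S.μ) (ψ : S.L2) :
    Integrable (fun x => f x * ‖ψ x‖ ^ 2) S.μ :=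
  (S.integrable_norm_sq ψ).bdd_mul hf.1 (S.ae_norm_le_eLpNorm hf)

lemma inner_mulReal_self (ψ : S.L2) :
    (inner ℂ ψ (S.mulReal f hf ψ)).re = ∫ x in S.region, f x * ‖ψ x‖ ^ 2 := by
  have h : inner ℂ ψ (S.mulReal f hf ψ) = ∫ x in S.region, ((f x * ‖ψ x‖ ^ 2 : ℝ) : ℂ) := by
    rw [L2.inner_def]
    refine integral_congr_ae ?_
    filter_upwards [S.mulReal_ae (hf := hf) ψ] with x h1
    simp only [h1, RCLike.inner_apply]
    rw [mul_assoc, Complex.mul_conj, Complex.normSq_eq_norm_sq]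
    push_cast
    ring
  rw [h, integral_complex_ofReal]
  exact Complex.ofReal_re _

lemma norm_sq_eq_integral (ψ : S.L2) : ‖ψ‖ ^ 2 = ∫ x in S.region, ‖ψ x‖ ^ 2 := by
  have h1 : MemLp (fun _ : Space d => (1 : ℝ)) ∞ S.μ := memLp_top_const 1
  have h2 : S.mulReal _ h1 ψ = ψ := by
    rw [mulReal, mulOp_eq_iff]
    exact Filter.Eventually.of_forall fun x => by simp
  have h3 := inner_mulReal_self (hf := h1) ψ
  rw [h2, inner_self_eq_norm_sq_to_K] at h3
  simp only [one_mul] at h3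
  rw [← h3]
  norm_cast

lemma norm_mulReal_sq (ψ : S.L2) :
    ‖S.mulReal f hf ψ‖ ^ 2 = ∫ x in S.region, f x ^ 2 * ‖ψ x‖ ^ 2 := by
  rw [norm_sq_eq_integral]
  refine integral_congr_ae ?_
  filter_upwards [S.mulReal_ae (hf := hf) ψ] with x h1
  simp only [h1, norm_mul, Complex.norm_real, mul_pow, Real.norm_eq_abs, sq_abs]

lemma memLp_norm_gradient {ρ : Space d → ℝ} (hρ : MemLp (gradient ρ) ∞ S.μ) :
    MemLp (fun x => ‖gradient ρ x‖ ^ 2) ∞ S.μ := by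
  refine memLp_top_of_bound (hρ.1.norm.pow 2) ((eLpNorm (gradient ρ) ∞ S.μ).toReal ^ 2) ?_
  filter_upwards [S.ae_norm_le_eLpNorm hρ] with x hx
  rw [norm_pow, norm_norm]
  gcongr

lemma integral_norm_gradient_sq_le {ρ : Space d → ℝ} (hρ : MemLp (gradient ρ) ∞ S.μ)
    (ψ : S.L2) :
    ∫ x in S.region, ‖gradient ρ x‖ ^ 2 * ‖ψ x‖ ^ 2 ≤ gradNorm S ρ ^ 2 * ‖ψ‖ ^ 2 := by
  rw [norm_sq_eq_integral, ← integral_const_mul]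
  refine integral_mono_ae (integrable_mul_norm_sq (memLp_norm_gradient hρ) ψ)
    ((integrable_norm_sq ψ).const_mul _) ?_
  filter_upwards [S.ae_norm_le_eLpNorm hρ] with x hx
  unfold gradNorm
  gcongr

lemma memLp_Vneg : MemLp (fun x => max (-S.V x) 0) ∞ S.μ := by
  refine S.memLp_V.mono (S.memLp_V.1.neg.sup aestronglyMeasurable_const) ?_
  refine Filter.Eventually.of_forall fun x => ?_
  rw [Real.norm_eq_abs, Real.norm_eq_abs, abs_of_nonneg (le_max_right _ _)]
  exact max_le (neg_le_abs _) (abs_nonneg _)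

lemma inner_V_ge (ψ : S.L2) :
    -S.normVneg * ‖ψ‖ ^ 2 ≤ (inner ℂ ψ (S.mulOp (S.memLp_complexV.toLp _) ψ)).re := by
  have h := inner_mulReal_self (hf := S.memLp_V) ψ
  unfold mulReal at h
  refine le_trans ?_ h.ge
  rw [norm_sq_eq_integral, ← integral_const_mul]
  refine integral_mono_ae ((integrable_norm_sq ψ).const_mul _)
    (integrable_mul_norm_sq S.memLp_V ψ) ?_
  filter_upwards [S.ae_norm_le_eLpNorm S.memLp_Vneg] with x hx
  refine mul_le_mul_of_nonneg_right ?_ (sq_nonneg _)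
  have h1 : -S.V x ≤ ‖max (-S.V x) 0‖ := (le_max_left _ _).trans (Real.le_norm_self _)
  unfold normVneg
  linarith

end Multiplication

/-! ### Partial derivatives and the Leibniz rule for the weak momentum. -/

section Derivative

/-- The `i`-th partial derivative. -/
def partialDeriv (i : Fin d) (f : Space d → ℝ) (x : Space d) : ℝ :=
  fderiv ℝ f x (EuclideanSpace.single i (1 : ℝ))

lemma sum_partialDeriv_sq (f : Space d → ℝ) (x : Space d) :
    ∑ i, partialDeriv i f x ^ 2 = ‖gradient f x‖ ^ 2 := by
  rw [EuclideanSpace.norm_sq_eq]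
  refine Finset.sum_congr rfl fun i _ => ?_
  have h : partialDeriv i f x = gradient f x i := by
    rw [partialDeriv, ← InnerProductSpace.toDual_symm_apply, EuclideanSpace.inner_single_right]
    simp [gradient]
  rw [h, Real.norm_eq_abs, sq_abs]

lemma abs_partialDeriv_le (i : Fin d) (f : Space d → ℝ) (x : Space d) :
    |partialDeriv i f x| ≤ ‖fderiv ℝ f x‖ := by
  have := (fderiv ℝ f x).le_opNorm (EuclideanSpace.single i (1 : ℝ))
  simpa [partialDeriv] using this

lemma continuous_partialDeriv (i : Fin d) {f : Space d → ℝ} (hf : ContDiff ℝ ∞ f) :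
    Continuous (partialDeriv i f) :=
  (hf.continuous_fderiv (by simp)).clm_apply continuous_const

/-- A smooth bounded function with bounded gradient. -/
structure IsMultiplier (η : Space d → ℝ) : Prop where
  contDiff : ContDiff ℝ ∞ η
  bounded : ∃ C : ℝ, ∀ x, |η x| ≤ C ∧ ‖fderiv ℝ η x‖ ≤ C

variable {S}

lemma IsMultiplier.memLp {η : Space d → ℝ} (hη : IsMultiplier η) : MemLp η ∞ S.μ := by
  obtain ⟨C, hC⟩ := hη.bounded
  exact memLp_top_of_bound hη.contDiff.continuous.aestronglyMeasurable C
    (Filter.Eventually.of_forall fun x => (hC x).1)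

lemma IsMultiplier.memLp_partialDeriv {η : Space d → ℝ} (hη : IsMultiplier η) (i : Fin d) :
    MemLp (partialDeriv i η) ∞ S.μ := by
  obtain ⟨C, hC⟩ := hη.bounded
  exact memLp_top_of_bound (continuous_partialDeriv i hη.contDiff).aestronglyMeasurable C
    (Filter.Eventually.of_forall fun x => (abs_partialDeriv_le i η x).trans (hC x).2)

lemma IsTest.mul {U : Set (Space d)} {φ η : Space d → ℝ} (hφ : IsTest U φ)
    (hη : ContDiff ℝ ∞ η) : IsTest U fun x => η x * φ x where
  contDiff := hη.mul hφ.contDiff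
  hasCompactSupport := hφ.hasCompactSupport.mul_left
  tsupport_subset := (tsupport_mul_subset_right).trans hφ.tsupport_subset

/-- The Leibniz rule `p(ηψ) = η pψ - iħ(∂η)ψ`: use the weak identity for `ψ` with the test function
`ηφ`. -/
lemma isWeakMomentum_mulReal {η : Space d → ℝ} (hη : IsMultiplier η) {i : Fin d} {ψ g : S.L2}
    (h : S.IsWeakMomentum i ψ g) :
    S.IsWeakMomentum i (S.mulReal η hη.memLp ψ)
      (S.mulReal η hη.memLp g
        - (Complex.I * S.hbar) • S.mulReal (partialDeriv i η) (hη.memLp_partialDeriv i) ψ) := by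
  intro φ hφ
  have h1 := h _ (IsTest.mul hφ hη.contDiff)
  have h2 : ∀ x, S.testMomentum i (fun x => η x * φ x) x
      = η x * S.testMomentum i φ x + Complex.I * S.hbar * (partialDeriv i η x * φ x) := by
    intro x
    have hd1 := (hη.contDiff.differentiable (by simp)) x
    have hd2 := (hφ.contDiff.differentiable (by simp)) x
    simp only [testMomentum, partialDeriv]
    rw [fderiv_fun_mul hd1 hd2]
    simp only [add_apply, smul_apply, smul_eq_mul]
    push_cast
    ring
  have i1 : Integrable (fun x => S.mulReal η hη.memLp ψ x * S.testMomentum i φ x) S.μ :=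
    S.integrable_mul _ (S.memLp_testMomentum i hφ)
  have i2 : Integrable (fun x => S.mulReal (partialDeriv i η) (hη.memLp_partialDeriv i) ψ x
      * (φ x : ℂ)) S.μ := S.integrable_mul _ (S.memLp_test hφ)
  have i3 : Integrable (fun x => S.mulReal η hη.memLp g x * (φ x : ℂ)) S.μ :=
    S.integrable_mul _ (S.memLp_test hφ)
  have e1 : ∫ x in S.region, ψ x * S.testMomentum i (fun x => η x * φ x) x
      = (∫ x in S.region, S.mulReal η hη.memLp ψ x * S.testMomentum i φ x)
        + Complex.I * S.hbar * ∫ x in S.region,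
          S.mulReal (partialDeriv i η) (hη.memLp_partialDeriv i) ψ x * (φ x : ℂ) := by
    rw [← integral_const_mul, ← integral_add i1 (i2.const_mul _)]
    refine integral_congr_ae ?_
    filter_upwards [mulReal_ae (hf := hη.memLp) ψ,
      mulReal_ae (hf := hη.memLp_partialDeriv i) ψ] with x hx1 hx2
    rw [h2, hx1, hx2]
    ring
  have e2 : ∫ x in S.region, g x * ((η x * φ x : ℝ) : ℂ)
      = ∫ x in S.region, S.mulReal η hη.memLp g x * (φ x : ℂ) := by
    refine integral_congr_ae ?_
    filter_upwards [mulReal_ae (hf := hη.memLp) g] with x hx1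
    rw [hx1]
    push_cast
    ring
  rw [e1, e2] at h1
  rw [eq_sub_of_add_eq h1, ← integral_const_mul, ← integral_sub i3 (i2.const_mul _)]
  refine integral_congr_ae ?_
  filter_upwards [Lp.coeFn_sub (S.mulReal η hη.memLp g)
      ((Complex.I * S.hbar) • S.mulReal (partialDeriv i η) (hη.memLp_partialDeriv i) ψ),
    Lp.coeFn_smul (Complex.I * (S.hbar : ℂ))
      (S.mulReal (partialDeriv i η) (hη.memLp_partialDeriv i) ψ)] with x hx1 hx2
  rw [hx1, Pi.sub_apply, hx2, Pi.smul_apply, smul_eq_mul]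
  ring

lemma isWeakMomentum_kin (i : Fin d) (ψ : S.sobolev) : S.IsWeakMomentum i ψ (S.kin i ψ) := by
  have h := (S.momentum i).mem_graph (Submodule.inclusion (iInf_le _ i) ψ)
  rw [momentum_graph] at h
  exact h

lemma kin_eq {i : Fin d} {ψ : S.sobolev} {g : S.L2} (h : S.IsWeakMomentum i ψ g) :
    S.kin i ψ = g := by
  have h1 : ((ψ : S.L2), S.kin i ψ) - ((ψ : S.L2), g) ∈ S.momentumGraph i :=
    Submodule.sub_mem _ (isWeakMomentum_kin i ψ) h
  have h2 := S.momentumGraph_single_valued i _ h1 (by simp)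
  exact sub_eq_zero.1 h2

lemma kin_mulReal {η : Space d → ℝ} (hη : IsMultiplier η) (i : Fin d) (ψ ψ' : S.sobolev)
    (h : (ψ' : S.L2) = S.mulReal η hη.memLp ψ) :
    S.kin i ψ' = S.mulReal η hη.memLp (S.kin i ψ)
      - (Complex.I * S.hbar) • S.mulReal (partialDeriv i η) (hη.memLp_partialDeriv i) ψ :=
  kin_eq (h ▸ isWeakMomentum_mulReal hη (isWeakMomentum_kin i ψ))

end Derivative

end System

section

variable {d : ℕ}

/-! ### Distances to periodized sets. -/

section Geometry

lemma infDist_periodize_add {Γ : AddSubgroup (Space d)} (s : Set (Space d)) {γ : Space d}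
    (hγ : γ ∈ Γ) (x : Space d) :
    Metric.infDist (x + γ) (periodize Γ s) = Metric.infDist x (periodize Γ s) := by
  have h : periodize Γ s = (fun z => z + γ) '' periodize Γ s := by
    ext z
    constructor
    · rintro ⟨a, ha, g, hg, rfl⟩
      exact ⟨a + (g - γ), ⟨a, ha, g - γ, Γ.sub_mem hg hγ, rfl⟩, by simp [add_assoc]⟩
    · rintro ⟨_, ⟨a, ha, g, hg, rfl⟩, rfl⟩
      exact ⟨a, ha, g + γ, Γ.add_mem hg hγ, add_assoc _ _ _⟩
  conv_lhs => rw [h]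
  exact Metric.infDist_image (isometry_add_right γ)

lemma subset_periodize (Γ : AddSubgroup (Space d)) (s : Set (Space d)) : s ⊆ periodize Γ s :=
  fun x hx => ⟨x, hx, 0, Γ.zero_mem, (add_zero x).symm⟩

lemma setDist_le_infDist (s : Set (Space d)) {t : Set (Space d)} {y : Space d} (hy : y ∈ t) :
    setDist s t ≤ Metric.infDist y s := by
  have hb : BddBelow {r | ∃ x ∈ s, ∃ y ∈ t, r = dist x y} :=
    ⟨0, by rintro _ ⟨x, _, y, _, rfl⟩; exact dist_nonneg⟩
  rcases s.eq_empty_or_nonempty with rfl | hs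
  -- For empty `s` both sides are `0` by convention.
  · simp [setDist]
  · rw [Metric.le_infDist hs]
    intro x hx
    rw [dist_comm]
    exact csInf_le hb ⟨x, hx, y, hy, rfl⟩

end Geometry

/-! ### The mollified distance function. -/

section Mollifier

variable {j : Space d → ℝ} {δ : ℝ}

lemma IsMollifier.hasCompactSupport (hj : IsMollifier j δ) : HasCompactSupport j :=
  (isCompact_closedBall 0 δ).of_isClosed_subset (isClosed_tsupport j) hj.tsupport_subset

lemma IsMollifier.integrable_mul (hj : IsMollifier j δ) {f : Space d → ℝ} (hf : Continuous f) :
    Integrable fun t => j t * f t :=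
  (hj.contDiff.continuous.mul hf).integrable_of_hasCompactSupport hj.hasCompactSupport.mul_right

/-- Averaging against a probability density preserves uniform bounds on its support. With `c` the
distance at `x` it compares `ρ` with the distance up to `δ`; with `c = 0` and a difference of two
translates it gives Lipschitz constant `1`. -/
lemma IsMollifier.abs_integral_sub_le (hj : IsMollifier j δ) {f : Space d → ℝ}
    (hf : Continuous f) {c D : ℝ} (h : ∀ t, ‖t‖ ≤ δ → |f t - c| ≤ D) :
    |(∫ t, j t * f t) - c| ≤ D := by
  have h1 : (∫ t, j t * f t) - c = ∫ t, j t * (f t - c) := by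
    have hc := hj.integrable_mul (continuous_const (y := c))
    simp only [mul_sub]
    rw [integral_sub (hj.integrable_mul hf) hc, integral_mul_const, hj.integral_eq_one, one_mul]
  have h2 : ∫ t, j t * D = D := by rw [integral_mul_const, hj.integral_eq_one, one_mul]
  rw [h1, ← Real.norm_eq_abs, ← h2]
  refine norm_integral_le_of_norm_le (hj.integrable_mul continuous_const)
    (Filter.Eventually.of_forall fun t => ?_)
  rw [norm_mul, Real.norm_of_nonneg (hj.nonneg t), Real.norm_eq_abs]
  by_cases ht : t ∈ tsupport j
  · exact mul_le_mul_of_nonneg_left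
      (h t (by simpa using hj.tsupport_subset ht)) (hj.nonneg t)
  · simp [image_eq_zero_of_notMem_tsupport ht]

lemma smoothDist_apply (j : Space d → ℝ) (Ω : Set (Space d)) (x : Space d) :
    smoothDist j Ω x = ∫ t, j t * Metric.infDist (x - t) Ω := rfl

lemma continuous_infDist_sub (Ω : Set (Space d)) (x : Space d) :
    Continuous fun t : Space d => Metric.infDist (x - t) Ω :=
  (Metric.continuous_infDist_pt Ω).comp (continuous_const.sub continuous_id)

lemma contDiff_smoothDist (hj : IsMollifier j δ) (Ω : Set (Space d)) :
    ContDiff ℝ ∞ (smoothDist j Ω) :=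
  hj.hasCompactSupport.contDiff_convolution_left _ hj.contDiff
    (Metric.continuous_infDist_pt Ω).locallyIntegrable

lemma smoothDist_nonneg (hj : IsMollifier j δ) (Ω : Set (Space d)) (x : Space d) :
    0 ≤ smoothDist j Ω x :=
  integral_nonneg fun t => mul_nonneg (hj.nonneg t) Metric.infDist_nonneg

lemma abs_infDist_sub_le (Ω : Set (Space d)) (x y : Space d) :
    |Metric.infDist x Ω - Metric.infDist y Ω| ≤ dist x y := by
  have := (Metric.lipschitz_infDist_pt Ω).dist_le_mul x y
  simpa [Real.dist_eq] using this

lemma abs_smoothDist_sub_infDist_le (hj : IsMollifier j δ) (Ω : Set (Space d)) (x : Space d) :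
    |smoothDist j Ω x - Metric.infDist x Ω| ≤ δ := by
  refine hj.abs_integral_sub_le (continuous_infDist_sub Ω x) fun t ht => ?_
  refine (abs_infDist_sub_le Ω _ _).trans ?_
  simpa [dist_eq_norm] using ht

lemma lipschitzWith_smoothDist (hj : IsMollifier j δ) (Ω : Set (Space d)) :
    LipschitzWith 1 (smoothDist j Ω) := by
  refine LipschitzWith.of_dist_le_mul fun x y => ?_
  have h := hj.abs_integral_sub_le (c := 0) (D := dist x y)
    ((continuous_infDist_sub Ω x).sub (continuous_infDist_sub Ω y)) (fun t _ => by
      rw [sub_zero]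
      refine (abs_infDist_sub_le Ω _ _).trans ?_
      simp)
  simp only [sub_zero, mul_sub, Pi.sub_apply] at h
  rw [integral_sub (hj.integrable_mul (continuous_infDist_sub Ω x))
    (hj.integrable_mul (continuous_infDist_sub Ω y))] at h
  rw [Real.dist_eq, smoothDist_apply, smoothDist_apply]
  simpa using h

/-- Invariance under the periods is what makes weights built from `ρ` admissible multipliers of the
form domain. -/
lemma smoothDist_periodize_add {Γ : AddSubgroup (Space d)} (s : Set (Space d)) {γ : Space d}
    (hγ : γ ∈ Γ) (x : Space d) :
    smoothDist j (periodize Γ s) (x + γ) = smoothDist j (periodize Γ s) x := by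
  simp only [smoothDist_apply]
  refine integral_congr_ae (Filter.Eventually.of_forall fun t => ?_)
  simp only
  rw [add_sub_right_comm, infDist_periodize_add s hγ]

lemma norm_gradient (f : Space d → ℝ) (x : Space d) : ‖gradient f x‖ = ‖fderiv ℝ f x‖ := by
  simp [gradient]

lemma norm_fderiv_smoothDist_le (hj : IsMollifier j δ) (Ω : Set (Space d)) (x : Space d) :
    ‖fderiv ℝ (smoothDist j Ω) x‖ ≤ 1 := by
  simpa using norm_fderiv_le_of_lipschitz ℝ (lipschitzWith_smoothDist hj Ω) (x₀ := x)

lemma memLp_gradient_smoothDist (S : System d) (hj : IsMollifier j δ) (Ω : Set (Space d)) :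
    MemLp (gradient (smoothDist j Ω)) ∞ S.μ := by
  refine memLp_top_of_bound ?_ 1 (Filter.Eventually.of_forall fun x => ?_)
  · have h : Continuous (gradient (smoothDist j Ω)) :=
      (InnerProductSpace.toDual ℝ (Space d)).symm.continuous.comp
        ((contDiff_smoothDist hj Ω).continuous_fderiv (by simp))
    exact h.aestronglyMeasurable
  · rw [norm_gradient]
    exact norm_fderiv_smoothDist_le hj Ω x

end Mollifier

/-! ### Truncated exponential weights. -/

section Truncation

/-- A bounded smooth truncation of the identity. -/
def truncArctan (N s : ℝ) : ℝ := N * Real.arctan (s / N)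

lemma truncArctan_mono {N : ℝ} (hN : 0 < N) : Monotone (truncArctan N) := fun s t h => by
  unfold truncArctan
  have : s / N ≤ t / N := by gcongr
  exact mul_le_mul_of_nonneg_left (Real.arctan_mono this) hN.le

lemma truncArctan_nonneg {N s : ℝ} (hN : 0 < N) (hs : 0 ≤ s) : 0 ≤ truncArctan N s :=
  mul_nonneg hN.le (Real.arctan_nonneg.2 (by positivity))

lemma truncArctan_le_self {N s : ℝ} (hN : 0 < N) (hs : 0 ≤ s) : truncArctan N s ≤ s := by
  have h : Real.arctan (s / N) ≤ s / N := by
    have h1 := Real.le_tan (Real.arctan_nonneg.2 (by positivity : 0 ≤ s / N))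
      (Real.arctan_lt_pi_div_two _)
    rwa [Real.tan_arctan] at h1
  calc N * Real.arctan (s / N) ≤ N * (s / N) := mul_le_mul_of_nonneg_left h hN.le
    _ = s := by field_simp

lemma abs_truncArctan_le {N : ℝ} (hN : 0 < N) (s : ℝ) :
    |truncArctan N s| ≤ N * (Real.pi / 2) := by
  rw [truncArctan, abs_mul, abs_of_pos hN]
  refine mul_le_mul_of_nonneg_left (abs_le.2 ⟨?_, ?_⟩) hN.le
  · exact (Real.neg_pi_div_two_lt_arctan _).le
  · exact (Real.arctan_lt_pi_div_two _).le

lemma contDiff_truncArctan (N : ℝ) : ContDiff ℝ ∞ (truncArctan N) :=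
  contDiff_const.mul (Real.contDiff_arctan.comp (contDiff_id.div_const N))

lemma hasDerivAt_truncArctan {N : ℝ} (hN : 0 < N) (s : ℝ) :
    HasDerivAt (truncArctan N) (1 / (1 + (s / N) ^ 2)) s := by
  have h1 : HasDerivAt (fun s : ℝ => s / N) (1 / N) s := (hasDerivAt_id s).div_const N
  have h2 := (h1.arctan).const_mul N
  refine h2.congr_deriv ?_
  field_simp

lemma tendsto_truncArctan (s : ℝ) :
    Filter.Tendsto (fun n : ℕ => truncArctan (n + 1 : ℝ) s) Filter.atTop (nhds s) := by
  -- With `t = s / N` the truncation equals `s · arctan t / t`, and `arctan` has slope `1` at `0`.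
  have h1 : Filter.Tendsto (fun t : ℝ => s * (t⁻¹ * Real.arctan t)) (nhdsWithin 0 {0}ᶜ)
      (nhds s) := by
    have := (Real.hasDerivAt_arctan 0).tendsto_slope_zero
    simp only [zero_add, Real.arctan_zero, sub_zero, smul_eq_mul] at this
    simpa using this.const_mul s
  rcases eq_or_ne s 0 with rfl | hs
  · simp [truncArctan]
  have h2 : Filter.Tendsto (fun n : ℕ => s / (n + 1 : ℝ)) Filter.atTop
      (nhdsWithin 0 {0}ᶜ) := by
    refine tendsto_nhdsWithin_iff.2 ⟨?_, Filter.Eventually.of_forall fun n => ?_⟩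
    · have := (tendsto_one_div_add_atTop_nhds_zero_nat (𝕜 := ℝ)).const_mul s
      simpa [div_eq_mul_inv] using this
    · have : (n + 1 : ℝ) ≠ 0 := by positivity
      simp [hs, this]
  refine (h1.comp h2).congr fun n => ?_
  have : (n + 1 : ℝ) ≠ 0 := by positivity
  simp only [Function.comp, truncArctan]
  field_simp

variable {ρ : Space d → ℝ}

/-- The truncation has derivative at most `1`, so bounds involving `|∇ρ|` remain available for the
truncated weight. -/
lemma norm_fderiv_truncArctan_comp_le {N : ℝ} (hN : 0 < N) (hρ : ContDiff ℝ ∞ ρ) (x : Space d) :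
    ‖fderiv ℝ (fun x => truncArctan N (ρ x)) x‖ ≤ ‖fderiv ℝ ρ x‖ := by
  have h1 := ((hρ.differentiable (by simp)) x).hasFDerivAt
  have h2 := (hasDerivAt_truncArctan hN (ρ x)).comp_hasFDerivAt x h1
  have h3 : fderiv ℝ (fun x => truncArctan N (ρ x)) x = _ := h2.fderiv
  rw [h3, norm_smul]
  refine mul_le_of_le_one_left (norm_nonneg _) ?_
  rw [Real.norm_of_nonneg (by positivity)]
  exact div_le_one_of_le₀ (by nlinarith [sq_nonneg (ρ x / N)]) (by positivity)

lemma isMultiplier_truncArctan_comp {N : ℝ} (hN : 0 < N) (hρ : ContDiff ℝ ∞ ρ)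
    (h1 : ∀ x, ‖fderiv ℝ ρ x‖ ≤ 1) : System.IsMultiplier fun x => truncArctan N (ρ x) where
  contDiff := (contDiff_truncArctan N).comp hρ
  bounded := ⟨max (N * (Real.pi / 2)) 1, fun x =>
    ⟨(abs_truncArctan_le hN _).trans (le_max_left _ _),
      ((norm_fderiv_truncArctan_comp_le hN hρ x).trans (h1 x)).trans (le_max_right _ _)⟩⟩

variable {θ : Space d → ℝ}

lemma hasFDerivAt_exp_neg_mul (hθ : ContDiff ℝ ∞ θ) (β : ℝ) (x : Space d) :
    HasFDerivAt (fun x => Real.exp (-β * θ x))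
      (Real.exp (-β * θ x) • (-β • fderiv ℝ θ x)) x :=
  (((hθ.differentiable (by simp)) x).hasFDerivAt.const_mul (-β)).exp

lemma isMultiplier_exp_neg_mul (hθ : System.IsMultiplier θ) {β : ℝ} (hβ : 0 ≤ β)
    (h0 : ∀ x, 0 ≤ θ x) : System.IsMultiplier fun x => Real.exp (-β * θ x) where
  contDiff := Real.contDiff_exp.comp (contDiff_const.mul hθ.contDiff)
  bounded := by
    obtain ⟨C, hC⟩ := hθ.bounded
    have h1 : ∀ x, Real.exp (-β * θ x) ≤ 1 := fun x =>
      Real.exp_le_one_iff.2 (by nlinarith [mul_nonneg hβ (h0 x)])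
    refine ⟨max 1 (β * C), fun x => ⟨?_, ?_⟩⟩
    · rw [abs_of_pos (Real.exp_pos _)]
      exact (h1 x).trans (le_max_left _ _)
    · refine le_trans ?_ (le_max_right _ _)
      rw [(hasFDerivAt_exp_neg_mul hθ.contDiff β x).fderiv, norm_smul, norm_smul, norm_neg,
        Real.norm_of_nonneg (Real.exp_pos _).le, Real.norm_of_nonneg hβ]
      have h2 : β * ‖fderiv ℝ θ x‖ ≤ β * C := mul_le_mul_of_nonneg_left (hC x).2 hβ
      exact (mul_le_of_le_one_left (by positivity) (h1 x)).trans h2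

lemma partialDeriv_exp_neg_mul (hθ : ContDiff ℝ ∞ θ) (β : ℝ) (i : Fin d) (x : Space d) :
    System.partialDeriv i (fun x => Real.exp (-β * θ x)) x
      = -β * (System.partialDeriv i θ x * Real.exp (-β * θ x)) := by
  rw [System.partialDeriv, (hasFDerivAt_exp_neg_mul hθ β x).fderiv]
  simp only [smul_apply, neg_smul, neg_apply, smul_eq_mul, System.partialDeriv]
  ring

end Truncation

end

/-! ### The Hamiltonian's form, its resolvent in the gap, and the spectral splitting. -/

section

variable {d : ℕ} {S : System d}

lemma System.isHermitianForm_form : IsHermitianForm S.form := by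
  have h1 : IsHermitianForm fun f g : S.L2 => inner ℂ f (S.mulOp (S.memLp_complexV.toLp _) g) :=
    IsHermitianForm.inner_symmetric fun f g => System.mulReal_symmetric (hf := S.memLp_V) f g
  have h2 := ((IsHermitianForm.sum fun i =>
    (IsHermitianForm.inner (H := S.L2)).comp (S.kin i)).const_mul (1 / (2 * S.mass))).add
      (h1.comp S.sobolev.subtype)
  convert h2 using 3
  rw [System.form]
  push_cast
  rfl

namespace BoundaryCondition

variable (B : BoundaryCondition S)

/-- The form of `H - E` on the form domain. -/
def shiftedForm (E : ℝ) (φ ψ : B.formDomain) : ℂ :=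
  S.form (B.incl φ) (B.incl ψ) - E * inner ℂ (φ : S.L2) (ψ : S.L2)

lemma isHermitianForm_shiftedForm (E : ℝ) : IsHermitianForm (B.shiftedForm E) := by
  have h := (S.isHermitianForm_form.comp B.incl).add
    (((IsHermitianForm.inner (H := S.L2)).comp B.formDomain.subtype).const_mul (-E))
  convert h using 3
  rw [shiftedForm]
  push_cast
  rw [sub_eq_add_neg, neg_mul]
  rfl

lemma shiftedForm_self_re (E : ℝ) (ψ : B.formDomain) :
    (B.shiftedForm E ψ ψ).re = (S.form (B.incl ψ) (B.incl ψ)).re - E * ‖(ψ : S.L2)‖ ^ 2 := by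
  rw [shiftedForm, inner_self_eq_norm_sq_to_K, Complex.sub_re, Complex.re_ofReal_mul]
  norm_cast

variable {B}

lemma form_resolvent {z : ℂ} {R : S.L2 →L[ℂ] S.L2} (hR : IsResolventAt B.hamiltonian z R)
    (f : S.L2) : ∃ h : R f ∈ B.formDomain, ∀ φ : B.formDomain,
      S.form (B.incl φ) (B.incl ⟨R f, h⟩) - z * inner ℂ (φ : S.L2) (R f)
        = inner ℂ (φ : S.L2) f := by
  obtain ⟨h, hf⟩ := hR.1 f
  have hg := B.hamiltonian.mem_graph ⟨R f, h⟩
  rw [hamiltonian_graph] at hg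
  obtain ⟨h', hg⟩ := hg
  refine ⟨h', fun φ => ?_⟩
  have h1 := hg φ
  simp only at h1
  rw [h1, ← inner_smul_right, ← inner_sub_right, hf]

lemma shiftedForm_resolvent {E : ℝ} {R : S.L2 →L[ℂ] S.L2} (hR : IsResolventAt B.hamiltonian E R)
    (f : S.L2) : ∃ h : R f ∈ B.formDomain, ∀ φ : B.formDomain,
      B.shiftedForm E φ ⟨R f, h⟩ = inner ℂ (φ : S.L2) f :=
  form_resolvent hR f

lemma isSelfAdjoint_resolvent {E : ℝ} {R : S.L2 →L[ℂ] S.L2}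
    (hR : IsResolventAt B.hamiltonian E R) : IsSelfAdjoint R := by
  rw [ContinuousLinearMap.isSelfAdjoint_iff_isSymmetric]
  exact fun f g => (B.isHermitianForm_shiftedForm E).inverse_symmetric
    (shiftedForm_resolvent hR) f g

section Gap

variable {Em E Ep m₀ : ℝ} (hgap : IsSpectralGap B.hamiltonian Em Ep) (hE : Em < E) (hE' : E < Ep)
  (hm : ∀ ψ : B.formDomain, m₀ * ‖(ψ : S.L2)‖ ^ 2 ≤ (S.form (B.incl ψ) (B.incl ψ)).re)
  {R : S.L2 →L[ℂ] S.L2} (hR : IsResolventAt B.hamiltonian E R)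

include hm hR

/-- The form bound tested at `Rv` reads `⟨Rv, v⟩ ≥ (m₀ - E)‖Rv‖²`, that is, `s + (E - m₀)s² ≥ 0` on
the spectrum. So negative spectrum of `R` stays away from `0`. -/
lemma one_le_of_mem_spectrum {s : ℝ} (hs : s ∈ spectrum ℝ R) (h0 : s < 0) :
    (E - m₀) * s ≤ -1 := by
  have h : 0 ≤ 1 * s + (E - m₀) * (s * s) := by
    refine spectrum_of_inner_add_norm_sq_nonneg (isSelfAdjoint_resolvent hR) (fun v => ?_) hs
    obtain ⟨h1, h2⟩ := shiftedForm_resolvent hR v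
    have h3 := hm ⟨R v, h1⟩
    have h4 := congrArg Complex.re (h2 ⟨R v, h1⟩)
    rw [shiftedForm_self_re] at h4
    simp only at h3 h4
    linarith
  nlinarith

include hgap hE

/-- The spectral point below the gap cannot lie below the form bound. Besides `E - m₀ > 0`, this
yields `Em + Ct ≥ C₀ > 0` when `m₀ = C₀ - Ct`. -/
lemma lower_bound_le_of_gap : m₀ ≤ Em := by
  obtain ⟨x, hx, hx'⟩ := hgap.2.2
  have h0 : x - E ≠ 0 := by linarith
  have h1 : (x - E)⁻¹ ∈ spectrum ℝ R := by
    by_contra h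
    refine hx' ?_
    have := mem_resolventSet_of_isUnit hR ((isUnit_one_sub_smul_iff h0).2 h)
    simpa using this
  have h2 := one_le_of_mem_spectrum hm hR h1 (inv_lt_zero.2 (by linarith))
  rw [← div_eq_mul_inv, div_le_iff_of_neg (by linarith)] at h2
  linarith

include hE'

lemma spectrum_resolvent {s : ℝ} (hs : s ∈ spectrum ℝ R) :
    (0 ≤ s ∧ (Ep - E) * s ≤ 1) ∨ ((E - m₀) * s ≤ -1 ∧ -1 ≤ (E - Em) * s) := by
  -- A nonzero `s` in the spectrum of `R` corresponds to the spectral value `E + 1/s` of the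
  -- Hamiltonian, which must avoid the gap.
  have key : s ≠ 0 → E + s⁻¹ ∉ Set.Ioo Em Ep := by
    intro h0 hmem
    have h1 := hgap.2.1 _ hmem
    rw [Complex.ofReal_add] at h1
    have h2 := isUnit_of_mem_resolventSet hR h1
    rw [isUnit_one_sub_smul_iff (inv_ne_zero h0), inv_inv] at h2
    exact h2 hs
  rcases lt_trichotomy s 0 with h | h | h
  · refine Or.inr ⟨one_le_of_mem_spectrum hm hR hs h, ?_⟩
    have h1 := key h.ne
    have h2 : s⁻¹ < 0 := inv_lt_zero.2 h
    have h3 : E + s⁻¹ ≤ Em := by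
      by_contra! h4
      exact h1 ⟨h4, by linarith⟩
    have h4 : s⁻¹ * s = 1 := inv_mul_cancel₀ h.ne
    nlinarith
  · exact Or.inl ⟨h.ge, by rw [h]; norm_num⟩
  · refine Or.inl ⟨h.le, ?_⟩
    have h1 := key h.ne'
    have h2 : 0 < s⁻¹ := inv_pos.2 h
    have h3 : Ep ≤ E + s⁻¹ := by
      by_contra! h4
      exact h1 ⟨by linarith, h4⟩
    have h4 : s⁻¹ * s = 1 := inv_mul_cancel₀ h.ne'
    nlinarith

/-- Decomposition of the form domain along a spectral gap. -/
lemma exists_gap_decomposition (ψ : B.formDomain) :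
    ∃ u w : B.formDomain, ψ = u + w ∧ inner ℂ (u : S.L2) (w : S.L2) = 0 ∧
      (Ep - E) * ‖(u : S.L2)‖ ^ 2 ≤ (B.shiftedForm E u u).re ∧
      (B.shiftedForm E w w).re ≤ -(E - Em) * ‖(w : S.L2)‖ ^ 2 := by
  have hm₀ := lower_bound_le_of_gap hgap hE hm hR
  obtain ⟨G, hGR, hPP, hP, hneg, hpos⟩ := exists_negative_part (isSelfAdjoint_resolvent hR)
    (x := E - Em) (y := Ep - E) (b := E - m₀) (by linarith)
    (fun s hs => spectrum_resolvent hgap hE hE' hm hR hs)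
  obtain ⟨hw, hw'⟩ := shiftedForm_resolvent hR (G ψ)
  -- `RG` is the projection below the gap. Being in the range of `R`, `w = RGψ` satisfies `q(w, w) =
  -- ⟨w, Gψ⟩`, which the functional calculus bounds directly.
  refine ⟨ψ - ⟨R (G ψ), hw⟩, ⟨R (G ψ), hw⟩, (sub_add_cancel _ _).symm, ?_, ?_, ?_⟩
  · change inner ℂ ((ψ : S.L2) - R (G ψ)) (R (G ψ)) = 0
    rw [inner_sub_left, hP, hPP, sub_self]
  -- `u` need not be in the operator domain, so the bootstrap is run on the kernel of the
  -- projection, invariant since `G` commutes with `R`.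
  · refine (B.isHermitianForm_shiftedForm E).lower_bound (shiftedForm_resolvent hR)
      (N := {u | R (G u) = 0}) (by linarith) (fun u hu => ?_) (fun u hu => ?_) (b := E - m₀)
      (fun u => ?_) _ ?_
    · have hu' : R (G u) = 0 := hu
      change R (G (u - _)) = 0
      rw [map_sub, map_sub, map_smul, map_smul, hGR, hu', map_zero, smul_zero, sub_zero]
    · have hu' : R (G u) = 0 := hu
      simpa [hu'] using hpos u
    · rw [shiftedForm_self_re]
      have := hm u
      linarith
    · change R (G ((ψ : S.L2) - R (G ψ))) = 0
      rw [map_sub, map_sub, hPP, sub_self]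
  · have h1 := hneg ψ
    rw [hw']
    simp only
    linarith

end Gap

end BoundaryCondition

end

/-! ### Conjugation of the form with the exponential weight. -/

section

variable {d : ℕ} {S : System d}

namespace System

/-- `∑ᵢ ‖(pᵢ + eAᵢ)ψ‖²`. -/
def kinSq (ψ : S.sobolev) : ℝ := ∑ i, ‖S.kin i ψ‖ ^ 2

/-- `∑ᵢ ‖(∂ᵢθ)ψ‖²`. -/
def gradSq {θ : Space d → ℝ} (hθ : IsMultiplier θ) (ψ : S.L2) : ℝ :=
  ∑ i, ‖S.mulReal (partialDeriv i θ) (hθ.memLp_partialDeriv i) ψ‖ ^ 2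

lemma kinSq_nonneg (ψ : S.sobolev) : 0 ≤ kinSq ψ := Finset.sum_nonneg fun _ _ => sq_nonneg _

lemma gradSq_nonneg {θ : Space d → ℝ} (hθ : IsMultiplier θ) (ψ : S.L2) : 0 ≤ gradSq hθ ψ :=
  Finset.sum_nonneg fun _ _ => sq_nonneg _

lemma form_self_ge (ψ : S.sobolev) :
    kinSq ψ / (2 * S.mass) - S.normVneg * ‖(ψ : S.L2)‖ ^ 2 ≤ (S.form ψ ψ).re := by
  have h1 : (1 / (2 * (S.mass : ℂ))) * ∑ i, inner ℂ (S.kin i ψ) (S.kin i ψ)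
      = ((kinSq ψ / (2 * S.mass) : ℝ) : ℂ) := by
    simp only [inner_self_eq_norm_sq_to_K, kinSq]
    push_cast
    rw [one_div, div_eq_inv_mul]
    rfl
  rw [form, h1, Complex.add_re, Complex.ofReal_re]
  have := S.inner_V_ge (ψ : S.L2)
  linarith

lemma gradSq_le_integral {θ ρ : Space d → ℝ} (hθ : IsMultiplier θ)
    (hρ : MemLp (gradient ρ) ∞ S.μ) (h : ∀ x, ‖gradient θ x‖ ≤ ‖gradient ρ x‖) (ψ : S.L2) :
    gradSq hθ ψ ≤ ∫ x in S.region, ‖gradient ρ x‖ ^ 2 * ‖ψ x‖ ^ 2 := by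
  have hi : ∀ i, Integrable (fun x => partialDeriv i θ x ^ 2 * ‖ψ x‖ ^ 2) S.μ := fun i => by
    have h1 : MemLp (fun x => partialDeriv i θ x ^ 2) ∞ S.μ := by
      have := (hθ.memLp_partialDeriv (S := S) i).mul (r := ∞) (hθ.memLp_partialDeriv (S := S) i)
      simp only [sq]
      exact this
    exact integrable_mul_norm_sq h1 ψ
  simp only [gradSq, norm_mulReal_sq]
  rw [← integral_finsetSum _ fun i _ => hi i]
  refine integral_mono (integrable_finsetSum _ fun i _ => hi i)
    (integrable_mul_norm_sq (memLp_norm_gradient hρ) ψ) fun x => ?_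
  simp only
  rw [← Finset.sum_mul, sum_partialDeriv_sq]
  have := h x
  gcongr

/-- The form obtained by conjugating `form` with `exp(-βθ)`, real part. -/
def conjRe {θ : Space d → ℝ} (hθ : IsMultiplier θ) (β : ℝ) (φ ψ : S.L2) : ℂ :=
  ((S.hbar ^ 2 * β ^ 2 / (2 * S.mass) : ℝ) : ℂ) *
    ∑ i, inner ℂ (S.mulReal (partialDeriv i θ) (hθ.memLp_partialDeriv i) φ)
      (S.mulReal (partialDeriv i θ) (hθ.memLp_partialDeriv i) ψ)

/-- The form obtained by conjugating `form` with `exp(-βθ)`, imaginary part. -/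
def conjIm {θ : Space d → ℝ} (hθ : IsMultiplier θ) (β : ℝ) (φ ψ : S.sobolev) : ℂ :=
  ((-(S.hbar * β / (2 * S.mass)) : ℝ) : ℂ) *
    ∑ i, (inner ℂ (S.kin i φ) (S.mulReal (partialDeriv i θ) (hθ.memLp_partialDeriv i) ψ)
      + inner ℂ (S.mulReal (partialDeriv i θ) (hθ.memLp_partialDeriv i) φ) (S.kin i ψ))

lemma isHermitianForm_conjRe {θ : Space d → ℝ} (hθ : IsMultiplier θ) (β : ℝ) :
    IsHermitianForm (conjRe (S := S) hθ β) :=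
  (IsHermitianForm.sum fun i => (IsHermitianForm.inner (H := S.L2)).comp
    (S.mulReal (partialDeriv i θ) (hθ.memLp_partialDeriv i)).toLinearMap).const_mul _

lemma isHermitianForm_conjIm {θ : Space d → ℝ} (hθ : IsMultiplier θ) (β : ℝ) :
    IsHermitianForm (conjIm (S := S) hθ β) :=
  (IsHermitianForm.sum fun i => IsHermitianForm.inner_add_inner (S.kin i)
    ((S.mulReal (partialDeriv i θ) (hθ.memLp_partialDeriv i)).toLinearMap
      ∘ₗ S.sobolev.subtype)).const_mul _

lemma conjRe_self_re {θ : Space d → ℝ} (hθ : IsMultiplier θ) (β : ℝ) (ψ : S.L2) :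
    (conjRe hθ β ψ ψ).re = S.hbar ^ 2 * β ^ 2 / (2 * S.mass) * gradSq hθ ψ := by
  rw [conjRe, Complex.re_ofReal_mul]
  congr 1
  simp only [inner_self_eq_norm_sq_to_K, gradSq, Complex.re_sum]
  refine Finset.sum_congr rfl fun i _ => ?_
  norm_cast

lemma norm_sum_inner_le {ι H : Type*} [Fintype ι] [NormedAddCommGroup H] [InnerProductSpace ℂ H]
    (f g : ι → H) :
    ‖∑ i, inner ℂ (f i) (g i)‖ ≤ √(∑ i, ‖f i‖ ^ 2) * √(∑ i, ‖g i‖ ^ 2) :=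
  ((norm_sum_le _ _).trans (Finset.sum_le_sum fun i _ => norm_inner_le_norm (f i) (g i))).trans
    (Real.sum_mul_le_sqrt_mul_sqrt _ _ _)

lemma norm_conjIm_le {θ : Space d → ℝ} (hθ : IsMultiplier θ) {β : ℝ} (hβ : 0 ≤ β)
    (φ ψ : S.sobolev) :
    ‖conjIm hθ β φ ψ‖ ≤ S.hbar * β / (2 * S.mass) *
      (√(kinSq φ) * √(gradSq hθ (ψ : S.L2)) + √(gradSq hθ (φ : S.L2)) * √(kinSq ψ)) := by
  have h1 := S.hbar_pos
  have h2 := S.mass_pos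
  rw [conjIm, norm_mul, Complex.norm_real, norm_neg, Real.norm_of_nonneg (by positivity)]
  refine mul_le_mul_of_nonneg_left ?_ (by positivity)
  rw [Finset.sum_add_distrib]
  exact (norm_add_le _ _).trans (add_le_add (norm_sum_inner_le _ _) (norm_sum_inner_le _ _))

/-- Conjugation of the form with `exp(-βθ)`. -/
lemma form_exp_mul {θ : Space d → ℝ} (hθ : IsMultiplier θ) {β : ℝ}
    (hη : IsMultiplier fun x => Real.exp (-β * θ x)) (χ χ' ψ₀ ψ : S.sobolev)
    (hχ : (χ' : S.L2) = S.mulReal _ hη.memLp χ) (hψ : (ψ : S.L2) = S.mulReal _ hη.memLp ψ₀) :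
    S.form χ' ψ₀ = S.form χ ψ - conjRe hθ β (χ : S.L2) ψ + Complex.I * conjIm hθ β χ ψ := by
  have hkin : ∀ φ φ' : S.sobolev, (φ' : S.L2) = S.mulReal _ hη.memLp φ → ∀ i,
      S.kin i φ' = S.mulReal _ hη.memLp (S.kin i φ) + (Complex.I * S.hbar * β) •
        S.mulReal (partialDeriv i θ) (hθ.memLp_partialDeriv i) (φ' : S.L2) := by
    intro φ φ' h i
    have h1 : S.mulReal _ (hη.memLp_partialDeriv i) (φ : S.L2)
        = (-β : ℂ) • S.mulReal (partialDeriv i θ) (hθ.memLp_partialDeriv i) (φ' : S.L2) := by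
      refine (S.mulOp_eq_iff (v := fun x =>
        ((partialDeriv i (fun x => Real.exp (-β * θ x)) x : ℝ) : ℂ))
        (hη.memLp_partialDeriv i).ofReal _ _).2 ?_
      filter_upwards [Lp.coeFn_smul (-β : ℂ)
          (S.mulReal (partialDeriv i θ) (hθ.memLp_partialDeriv i) (φ' : S.L2)),
        mulReal_ae (hf := hθ.memLp_partialDeriv i) (φ' : S.L2),
        mulReal_ae (hf := hη.memLp) (φ : S.L2)] with x h1 h2 h3
      rw [h1, Pi.smul_apply, h2, h, h3, partialDeriv_exp_neg_mul hθ.contDiff, smul_eq_mul]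
      simp only [Complex.ofReal_mul, Complex.ofReal_neg]
      ring
    rw [kin_mulReal hη i φ φ' h, h1, smul_smul, sub_eq_add_neg, ← neg_smul]
    congr 2
    ring
  -- The same identity with the weight factored out on the left, for use on the test side. Moving it
  -- across the inner product onto `ψ₀` avoids the growing weight `e^{βθ}`.
  have hkin' : ∀ φ φ' : S.sobolev, (φ' : S.L2) = S.mulReal _ hη.memLp φ → ∀ i,
      S.kin i φ' = S.mulReal _ hη.memLp (S.kin i φ + (Complex.I * S.hbar * β) •
        S.mulReal (partialDeriv i θ) (hθ.memLp_partialDeriv i) (φ : S.L2)) := by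
    intro φ φ' h i
    rw [hkin φ φ' h i, map_add, map_smul, h, mulReal_comm]
  have h1 : ∀ i, inner ℂ (S.kin i χ') (S.kin i ψ₀)
      = inner ℂ (S.kin i χ) (S.kin i ψ)
        - Complex.I * S.hbar * β *
          (inner ℂ (S.kin i χ)
              (S.mulReal (partialDeriv i θ) (hθ.memLp_partialDeriv i) (ψ : S.L2))
            + inner ℂ (S.mulReal (partialDeriv i θ) (hθ.memLp_partialDeriv i) (χ : S.L2))
              (S.kin i ψ))
        - (S.hbar ^ 2 * β ^ 2 : ℝ) *
          inner ℂ (S.mulReal (partialDeriv i θ) (hθ.memLp_partialDeriv i) (χ : S.L2))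
            (S.mulReal (partialDeriv i θ) (hθ.memLp_partialDeriv i) (ψ : S.L2)) := by
    intro i
    have h2 : S.mulReal _ hη.memLp (S.kin i ψ₀) = S.kin i ψ - (Complex.I * S.hbar * β) •
        S.mulReal (partialDeriv i θ) (hθ.memLp_partialDeriv i) (ψ : S.L2) :=
      eq_sub_of_add_eq (hkin ψ₀ ψ hψ i).symm
    rw [hkin' χ χ' hχ i, mulReal_symmetric, h2, inner_add_left, inner_sub_right, inner_sub_right,
      inner_smul_left, inner_smul_right, inner_smul_left, inner_smul_right]
    simp only [map_mul, Complex.conj_I, Complex.conj_ofReal]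
    push_cast
    linear_combination (-(S.hbar : ℂ) ^ 2 * β ^ 2 *
      inner ℂ (S.mulReal (partialDeriv i θ) (hθ.memLp_partialDeriv i) (χ : S.L2))
        (S.mulReal (partialDeriv i θ) (hθ.memLp_partialDeriv i) (ψ : S.L2))) * -Complex.I_sq
  have h2 : inner ℂ (χ' : S.L2) (S.mulOp (S.memLp_complexV.toLp _) (ψ₀ : S.L2))
      = inner ℂ (χ : S.L2) (S.mulOp (S.memLp_complexV.toLp _) (ψ : S.L2)) := by
    rw [hχ, hψ, mulReal_symmetric]
    congr 1
    exact mulReal_comm (hf := hη.memLp) (hg := S.memLp_V) (ψ₀ : S.L2)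
  rw [form, form, h2, conjRe, conjIm]
  simp only [h1, Finset.sum_sub_distrib, ← Finset.mul_sum]
  push_cast
  ring

end System

/-- The scalar inequalities behind the estimate; equality in `hκ` is what fixes the decay rate. -/
lemma gap_estimate {m C₀ Y Z x y s κ a c J Gβ t nu nw ku kw gu gw : ℝ} (hm : 0 < m)
    (hC : 0 < C₀) (hY : 0 < Y) (hx : 0 < x) (hs : 0 < s)
    (hEY : s + t ≤ Y) (hEZ : t - x = Z) (ht : 0 ≤ t)
    (hκ : 16 * κ ^ 2 * y * (Y * Z) = C₀ * (s * x))
    (hβ : Gβ ^ 2 ≤ 2 * m * (κ ^ 2 * y))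
    (hku : 0 ≤ ku) (hkw : 0 ≤ kw)
    (ha : s * nu ^ 2 ≤ a) (hc : x * nw ^ 2 ≤ c)
    (hTu : C₀ * nu ^ 2 ≤ a + t * nu ^ 2) (hTw : C₀ * nw ^ 2 ≤ -c + t * nw ^ 2)
    (hKu : ku ^ 2 ≤ 2 * m * (a + t * nu ^ 2)) (hKw : kw ^ 2 ≤ 2 * m * (-c + t * nw ^ 2))
    (hgu : gu ≤ Gβ * nu) (hgw : gw ≤ Gβ * nw)
    (hJ : J ≤ 1 / (2 * m) * (ku * gw + gu * kw)) :
    C₀ * (nu ^ 2 + nw ^ 2) ≤ 2 * max (Y / s) (Z / x) * (a - -c - 2 * J) := by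
  -- With `a = A(u,u)`, `c = -A(w,w)` and `t = E + Ct`, these are the shifted energies of `u` and
  -- `w`. The gap gives `Tu ≤ (Y/s)a` and `Tw ≤ (Z/x)c`.
  set Tu := a + t * nu ^ 2 with hTu'
  set Tw := -c + t * nw ^ 2 with hTw'
  have ha0 : 0 ≤ a := le_trans (by positivity) ha
  have hc0 : 0 ≤ c := le_trans (by positivity) hc
  have hTu0 : 0 ≤ Tu := le_trans (by positivity) hTu
  have hTw0 : 0 ≤ Tw := le_trans (by positivity) hTw
  have h1 : s * Tu ≤ Y * a := by
    have : t * (s * nu ^ 2) ≤ t * a := mul_le_mul_of_nonneg_left ha ht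
    have h0 := mul_le_mul_of_nonneg_right hEY ha0
    rw [hTu']
    linarith
  have h2 : x * Tw ≤ Z * c := by
    have : t * (x * nw ^ 2) ≤ t * c := mul_le_mul_of_nonneg_left hc ht
    rw [hTw', ← hEZ]
    linarith
  -- In each product one factor is a kinetic energy, at most `2mT`, and the other a squared norm, at
  -- most `T / C₀`.
  have h3 : (ku * nw) ^ 2 ≤ 2 * m * Tu * Tw / C₀ := by
    rw [le_div_iff₀ hC]
    calc (ku * nw) ^ 2 * C₀ = ku ^ 2 * (C₀ * nw ^ 2) := by ring
      _ ≤ (2 * m * Tu) * Tw := by gcongr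
  have h4 : (nu * kw) ^ 2 ≤ 2 * m * Tu * Tw / C₀ := by
    rw [le_div_iff₀ hC]
    calc (nu * kw) ^ 2 * C₀ = (C₀ * nu ^ 2) * kw ^ 2 := by ring
      _ ≤ Tu * (2 * m * Tw) := by gcongr
      _ = 2 * m * Tu * Tw := by ring
  have h5 : 2 * J ≤ Gβ / m * (ku * nw + nu * kw) := by
    calc 2 * J ≤ 2 * (1 / (2 * m) * (ku * (Gβ * nw) + Gβ * nu * kw)) := by
          refine mul_le_mul_of_nonneg_left (hJ.trans ?_) (by norm_num)
          gcongr
      _ = Gβ / m * (ku * nw + nu * kw) := by field_simp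
  have h6 : (Gβ / m * (ku * nw + nu * kw)) ^ 2 ≤ a * c := by
    -- The factor `4` here and the two factors `2m` in the chain below make up the `16` in `κ`.
    have e1 : (ku * nw + nu * kw) ^ 2 ≤ 4 * (2 * m * Tu * Tw / C₀) := by
      linarith [sq_nonneg (ku * nw - nu * kw)]
    have e2 : (s * Tu) * (x * Tw) ≤ (Y * a) * (Z * c) := by gcongr
    have e4 : 0 ≤ κ ^ 2 * y := by
      have : 0 ≤ 2 * m * (κ ^ 2 * y) := le_trans (sq_nonneg _) hβ
      exact nonneg_of_mul_nonneg_right this (by positivity)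
    calc (Gβ / m * (ku * nw + nu * kw)) ^ 2
        = Gβ ^ 2 / m ^ 2 * (ku * nw + nu * kw) ^ 2 := by ring
      _ ≤ (2 * m * (κ ^ 2 * y)) / m ^ 2 * (4 * (2 * m * Tu * Tw / C₀)) := by gcongr
      _ = 16 * (κ ^ 2 * y) / (C₀ * (s * x)) * ((s * Tu) * (x * Tw)) := by field_simp; ring
      _ ≤ 16 * (κ ^ 2 * y) / (C₀ * (s * x)) * ((Y * a) * (Z * c)) := by gcongr
      _ = (16 * κ ^ 2 * y * (Y * Z)) / (C₀ * (s * x)) * (a * c) := by ring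
      _ = a * c := by rw [hκ, div_self (by positivity), one_mul]
  -- `2J ≤ √(ac)`, and the arithmetic-geometric mean inequality leaves half of `a + c`.
  have h7 : 2 * J ≤ (a + c) / 2 := by
    refine h5.trans ((le_abs_self _).trans (abs_le_of_sq_le_sq (h6.trans ?_) (by positivity)))
    linarith [sq_nonneg (a - c)]
  have h8 : C₀ * nu ^ 2 ≤ max (Y / s) (Z / x) * a := by
    refine hTu.trans (le_trans ?_ (mul_le_mul_of_nonneg_right (le_max_left _ _) ha0))
    rw [div_mul_eq_mul_div, le_div_iff₀ hs]
    linarith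
  have h9 : C₀ * nw ^ 2 ≤ max (Y / s) (Z / x) * c := by
    refine hTw.trans (le_trans ?_ (mul_le_mul_of_nonneg_right (le_max_right _ _) hc0))
    rw [div_mul_eq_mul_div, le_div_iff₀ hx]
    linarith
  have h10 : 0 ≤ max (Y / s) (Z / x) := le_trans (by positivity) (le_max_left (Y / s) _)
  linarith [mul_le_mul_of_nonneg_left h7 h10]

end

section

variable {d : ℕ} {S : System d} {B : BoundaryCondition S}

/-! ### Algebra of `κ` and `β`. -/

section Parameters

variable {C₀ Ct Em E Ep : ℝ}

lemma kappa_sq (hC : 0 < C₀) (hE : Em < E) (hE' : E < Ep) (hZ : 0 < Em + Ct) :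
    kappa C₀ Ct Em E Ep ^ 2
      = C₀ * (E - Em) / (C₀ * (E - Em) + 16 * (Ep + Ct) * (Em + Ct)) := by
  have hx : 0 < E - Em := by linarith
  have hY : 0 < Ep + Ct := by linarith
  rw [kappa, Real.sq_sqrt (by positivity)]

lemma one_sub_kappa_sq_pos (hC : 0 < C₀) (hE : Em < E) (hE' : E < Ep) (hZ : 0 < Em + Ct) :
    0 < 1 - kappa C₀ Ct Em E Ep ^ 2 := by
  have hx : 0 < E - Em := by linarith
  have hY : 0 < Ep + Ct := by linarith
  have h : 0 < 16 * (Ep + Ct) * (Em + Ct) := by positivity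
  rw [kappa_sq hC hE hE' hZ, sub_pos, div_lt_one (by positivity)]
  linarith

/-- `κ²` is the solution of `16κ²YZ = C₀(1 - κ²)x` with `x = E - Em`, `Y = Ep + Ct`, `Z = Em + Ct`.
-/
lemma kappa_sq_identity (hC : 0 < C₀) (hE : Em < E) (hE' : E < Ep) (hZ : 0 < Em + Ct) :
    16 * kappa C₀ Ct Em E Ep ^ 2 * (Ep - E) * ((Ep + Ct) * (Em + Ct))
      = C₀ * ((1 - kappa C₀ Ct Em E Ep ^ 2) * (Ep - E) * (E - Em)) := by
  have hx : 0 < E - Em := by linarith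
  have hY : 0 < Ep + Ct := by linarith
  have h : C₀ * (E - Em) + 16 * (Ep + Ct) * (Em + Ct) ≠ 0 := by positivity
  rw [kappa_sq hC hE hE' hZ]
  field_simp
  ring

lemma beta_nonneg {G : ℝ} (hG : 0 ≤ G) : 0 ≤ beta S G C₀ Ct Em E Ep := by
  have := S.hbar_pos
  unfold beta
  positivity

/-- An equality for `G > 0`; only at `G = 0`, where the left side vanishes, can it be strict. -/
lemma beta_sq_le {G : ℝ} (hG : 0 ≤ G) (hC : 0 < C₀) (hE : Em < E) (hE' : E < Ep)
    (hZ : 0 < Em + Ct) :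
    (S.hbar * beta S G C₀ Ct Em E Ep * G) ^ 2
      ≤ 2 * S.mass * (kappa C₀ Ct Em E Ep ^ 2 * (Ep - E)) := by
  have hx : 0 < E - Em := by linarith
  have hy : 0 < Ep - E := by linarith
  have hY : 0 < Ep + Ct := by linarith
  have hm := S.mass_pos
  have hh := S.hbar_pos
  rcases hG.eq_or_lt with rfl | hG
  · rw [mul_zero, zero_pow two_ne_zero]
    positivity
  · have h1 : S.hbar * beta S G C₀ Ct Em E Ep * G = √(2 * S.mass) *
        √(C₀ * (Ep - E) * (E - Em) / (C₀ * (E - Em) + 16 * (Ep + Ct) * (Em + Ct))) := by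
      rw [beta]
      field_simp
    rw [h1, mul_pow, Real.sq_sqrt (by positivity), Real.sq_sqrt (by positivity),
      kappa_sq hC hE hE' hZ]
    refine le_of_eq ?_
    ring

end Parameters

/-! ### The exponentially weighted estimate. -/

section Weighted

lemma BoundaryCondition.mulReal_mem {η : Space d → ℝ} (hη : System.IsMultiplier η)
    (hper : ∀ γ ∈ B.periods, ∀ x, η (x + γ) = η x) (ψ : B.formDomain) :
    S.mulReal η hη.memLp (ψ : S.L2) ∈ B.formDomain :=
  B.mul_mem η hη.contDiff hη.bounded hper ψ ψ.2 _ (System.mulReal_ae _)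

variable {Em E Ep C₀ Ct β κ : ℝ} {ρ θ : Space d → ℝ}

lemma Admissible.form_lower_bound (h : Admissible B ρ β C₀ Ct) (ψ : B.formDomain) :
    (C₀ - Ct) * ‖(ψ : S.L2)‖ ^ 2 ≤ (S.form (B.incl ψ) (B.incl ψ)).re := by
  have h1 := h.form_ge ψ
  have hm := S.mass_pos
  have h2 : 0 ≤ S.hbar ^ 2 * β ^ 2 / (2 * S.mass)
      * ∫ x in S.region, ‖gradient ρ x‖ ^ 2 * ‖(ψ : S.L2) x‖ ^ 2 :=
    mul_nonneg (by positivity) (integral_nonneg fun x => by positivity)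
  linarith

/-- Exponentially weighted estimate for solutions of `(H - E - iε)ψ₀ = F`. -/
lemma norm_exp_mul_le (hgap : IsSpectralGap B.hamiltonian Em Ep) (hE : Em < E) (hE' : E < Ep)
    (hρ : MemLp (gradient ρ) ∞ S.μ) (hadm : Admissible B ρ β C₀ Ct) (hβ : 0 ≤ β)
    (hκ : 16 * κ ^ 2 * (Ep - E) * ((Ep + Ct) * (Em + Ct))
      = C₀ * ((1 - κ ^ 2) * (Ep - E) * (E - Em)))
    (hκ' : 0 < 1 - κ ^ 2)
    (hβκ : (S.hbar * β * gradNorm S ρ) ^ 2 ≤ 2 * S.mass * (κ ^ 2 * (Ep - E)))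
    (hθ : System.IsMultiplier θ) (hθρ : ∀ x, ‖gradient θ x‖ ≤ ‖gradient ρ x‖)
    (hper : ∀ γ ∈ B.periods, ∀ x, θ (x + γ) = θ x)
    (hη : System.IsMultiplier fun x => Real.exp (-β * θ x)) (ε : ℝ) (ψ₀ : B.formDomain) (F : S.L2)
    (hF : ∀ φ : B.formDomain, S.form (B.incl φ) (B.incl ψ₀)
      - ((E : ℂ) + ε * Complex.I) * inner ℂ (φ : S.L2) (ψ₀ : S.L2) = inner ℂ (φ : S.L2) F) :
    ‖S.mulReal _ hη.memLp (ψ₀ : S.L2)‖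
      ≤ 2 * (C₀⁻¹ * max ((Ep + Ct) / ((1 - κ ^ 2) * (Ep - E))) ((Em + Ct) / (E - Em)))
        * ‖S.mulReal _ hη.memLp F‖ := by
  have hC := hadm.pos
  have hx : 0 < E - Em := by linarith
  have hy : 0 < Ep - E := by linarith
  have hmass := S.mass_pos
  have hhbar := S.hbar_pos
  have hm := hadm.form_lower_bound
  obtain ⟨R, hR⟩ := hgap.2.1 E ⟨hE, hE'⟩
  have hm₀ := BoundaryCondition.lower_bound_le_of_gap hgap hE hm hR
  have hper' : ∀ γ ∈ B.periods, ∀ x,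
      Real.exp (-β * θ (x + γ)) = Real.exp (-β * θ x) := fun γ hγ x => by rw [hper γ hγ]
  have hmem := fun φ : B.formDomain => B.mulReal_mem hη hper' φ
  obtain ⟨u, w, huw, horth, hu, hw⟩ := BoundaryCondition.exists_gap_decomposition hgap hE hE' hm hR
    ⟨_, hmem ψ₀⟩
  have huw' : S.mulReal _ hη.memLp (ψ₀ : S.L2) = ((u + w : B.formDomain) : S.L2) :=
    congrArg Subtype.val huw
  -- The test function is `e^{-βθ}(u - w)`; after conjugation its weight falls on the solution and
  -- on `F`.
  have h1 := hF ⟨_, hmem (u - w)⟩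
  rw [System.form_exp_mul hθ hη (B.incl (u - w)) (B.incl ⟨_, hmem (u - w)⟩) (B.incl ψ₀)
    (B.incl (u + w)) rfl huw'.symm] at h1
  simp only at h1
  rw [System.mulReal_symmetric, System.mulReal_symmetric, huw'] at h1
  have hA : IsHermitianForm fun φ ψ : B.formDomain =>
      B.shiftedForm E φ ψ - System.conjRe hθ β (φ : S.L2) (ψ : S.L2) :=
    (B.isHermitianForm_shiftedForm E).sub
      ((System.isHermitianForm_conjRe hθ β).comp B.formDomain.subtype)
  have hJ : IsHermitianForm fun φ ψ : B.formDomain =>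
      System.conjIm hθ β (B.incl φ) (B.incl ψ) :=
    (System.isHermitianForm_conjIm hθ β).comp B.incl
  have h2 := IsHermitianForm.re_sub_add_ge hA hJ B.formDomain.subtype ε (u := u) (w := w) horth
  have h3 : (inner ℂ ((u - w : B.formDomain) : S.L2) (S.mulReal _ hη.memLp F)).re
      ≤ ‖((u - w : B.formDomain) : S.L2)‖ * ‖S.mulReal _ hη.memLp F‖ :=
    (Complex.re_le_norm _).trans (norm_inner_le_norm _ _)
  rw [← h1] at h3
  have hincl : ∀ φ : B.formDomain, (B.incl φ : S.L2) = φ := fun _ => rfl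
  replace h3 := le_trans (h2.trans_eq (by
    rw [BoundaryCondition.shiftedForm, hincl, hincl]
    simp only [Submodule.subtype_apply]
    congr 1
    ring)) h3
  have hgrad : ∀ ψ : S.L2, System.gradSq hθ ψ ≤ gradNorm S ρ ^ 2 * ‖ψ‖ ^ 2 := fun ψ =>
    (System.gradSq_le_integral hθ hρ hθρ ψ).trans (System.integral_norm_gradient_sq_le hρ ψ)
  have hG0 : 0 ≤ gradNorm S ρ := ENNReal.toReal_nonneg
  have hgrad' : ∀ ψ : S.L2, √(System.gradSq hθ ψ) ≤ gradNorm S ρ * ‖ψ‖ := fun ψ =>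
    Real.sqrt_le_iff.2 ⟨by positivity, by rw [mul_pow]; exact hgrad ψ⟩
  have hAre : ∀ ψ : B.formDomain, (B.shiftedForm E ψ ψ - System.conjRe hθ β (ψ : S.L2) ψ).re
      = (S.form (B.incl ψ) (B.incl ψ)).re - E * ‖(ψ : S.L2)‖ ^ 2
        - S.hbar ^ 2 * β ^ 2 / (2 * S.mass) * System.gradSq hθ (ψ : S.L2) := fun ψ => by
    rw [Complex.sub_re, B.shiftedForm_self_re, System.conjRe_self_re]
  have hk : 0 ≤ S.hbar ^ 2 * β ^ 2 / (2 * S.mass) := by positivity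
  have hT : ∀ ψ : B.formDomain, C₀ * ‖(ψ : S.L2)‖ ^ 2
      ≤ (B.shiftedForm E ψ ψ - System.conjRe hθ β (ψ : S.L2) ψ).re
        + (E + Ct) * ‖(ψ : S.L2)‖ ^ 2 := fun ψ => by
    have e1 := hadm.form_ge ψ
    have e2 := mul_le_mul_of_nonneg_left (System.gradSq_le_integral hθ hρ hθρ (ψ : S.L2)) hk
    rw [hAre]
    linarith
  -- The first admissibility condition enters here: `Ct` outweighs both `V⁻` and the gradient term,
  -- so the shifted energy controls the kinetic energy.
  have hK : ∀ ψ : B.formDomain, √(System.kinSq (B.incl ψ)) ^ 2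
      ≤ 2 * S.mass * ((B.shiftedForm E ψ ψ - System.conjRe hθ β (ψ : S.L2) ψ).re
        + (E + Ct) * ‖(ψ : S.L2)‖ ^ 2) := fun ψ => by
    have e1 : System.kinSq (B.incl ψ) / (2 * S.mass) - S.normVneg * ‖(ψ : S.L2)‖ ^ 2
      ≤ (S.form (B.incl ψ) (B.incl ψ)).re := System.form_self_ge (B.incl ψ)
    have e2 := mul_le_mul_of_nonneg_left (hgrad (ψ : S.L2)) hk
    have e3 := mul_nonneg hadm.potential.le (sq_nonneg ‖(ψ : S.L2)‖)
    rw [Real.sq_sqrt (System.kinSq_nonneg _), mul_comm (2 * S.mass), ← div_le_iff₀ (by positivity),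
      hAre]
    linarith
  have hβκ' : S.hbar ^ 2 * β ^ 2 / (2 * S.mass) * gradNorm S ρ ^ 2 ≤ κ ^ 2 * (Ep - E) := by
    rw [div_mul_eq_mul_div, div_le_iff₀ (by positivity)]
    linarith
  -- Above the gap the gradient term costs at most the fraction `κ²` of `Ep - E`; below the gap its
  -- sign is favourable.
  have ha : (1 - κ ^ 2) * (Ep - E) * ‖(u : S.L2)‖ ^ 2
      ≤ (B.shiftedForm E u u - System.conjRe hθ β (u : S.L2) u).re := by
    have e2 := mul_le_mul_of_nonneg_left (hgrad (u : S.L2)) hk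
    have e3 := mul_le_mul_of_nonneg_right hβκ' (sq_nonneg ‖(u : S.L2)‖)
    rw [Complex.sub_re, System.conjRe_self_re]
    linarith
  have hc : (E - Em) * ‖(w : S.L2)‖ ^ 2
      ≤ -(B.shiftedForm E w w - System.conjRe hθ β (w : S.L2) w).re := by
    have e2 := mul_nonneg hk (System.gradSq_nonneg hθ (w : S.L2))
    rw [Complex.sub_re, System.conjRe_self_re]
    linarith
  have key := gap_estimate (Y := Ep + Ct) (Z := Em + Ct) (t := E + Ct)
    (Gβ := S.hbar * β * gradNorm S ρ)
    (ku := √(System.kinSq (B.incl u))) (kw := √(System.kinSq (B.incl w)))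
    (gu := S.hbar * β * √(System.gradSq hθ (u : S.L2)))
    (gw := S.hbar * β * √(System.gradSq hθ (w : S.L2)))
    (J := ‖System.conjIm hθ β (B.incl u) (B.incl w)‖)
    hmass hC (by linarith) hx (mul_pos hκ' hy)
    (by nlinarith [sq_nonneg κ]) (by ring) (by linarith) hκ hβκ
    (Real.sqrt_nonneg _) (Real.sqrt_nonneg _) ha hc
    (hT u) (by rw [neg_neg]; exact hT w) (hK u) (by rw [neg_neg]; exact hK w)
    (by
      rw [mul_assoc (S.hbar * β)]
      exact mul_le_mul_of_nonneg_left (hgrad' u) (by positivity))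
    (by
      rw [mul_assoc (S.hbar * β)]
      exact mul_le_mul_of_nonneg_left (hgrad' w) (by positivity))
    ((System.norm_conjIm_le hθ hβ _ _).trans_eq (by
      change _ * (_ * √(System.gradSq hθ (w : S.L2)) + √(System.gradSq hθ (u : S.L2)) * _) = _
      ring))
  set M := max ((Ep + Ct) / ((1 - κ ^ 2) * (Ep - E))) ((Em + Ct) / (E - Em)) with hM
  have hM0 : 0 ≤ M := le_trans (div_nonneg (by linarith) hx.le) (le_max_right _ _)
  have hadd : ‖((u + w : B.formDomain) : S.L2)‖ ^ 2
      = ‖(u : S.L2)‖ ^ 2 + ‖(w : S.L2)‖ ^ 2 := by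
    rw [Submodule.coe_add, @norm_add_sq ℂ, horth]
    simp
  -- Orthogonality makes the test vector as long as `ψ`, so one factor of the norm cancels at the
  -- end.
  have hsub : ‖((u - w : B.formDomain) : S.L2)‖ = ‖((u + w : B.formDomain) : S.L2)‖ := by
    rw [← sq_eq_sq₀ (norm_nonneg _) (norm_nonneg _), hadd, Submodule.coe_sub, @norm_sub_sq ℂ,
      horth]
    simp
  rw [huw']
  rw [hsub] at h3
  rw [neg_neg, ← hadd] at key
  set n := ‖((u + w : B.formDomain) : S.L2)‖ with hn
  set f := ‖S.mulReal _ hη.memLp F‖ with hf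
  have h4 : C₀ * n ^ 2 ≤ 2 * M * (n * f) :=
    key.trans (mul_le_mul_of_nonneg_left h3 (by positivity))
  have hn0 : 0 ≤ n := norm_nonneg _
  have hf0 : 0 ≤ f := norm_nonneg _
  rcases hn0.eq_or_lt with h0 | h0
  · rw [← h0]
    positivity
  · have h5 : C₀ * n ≤ 2 * M * f := le_of_mul_le_mul_right (by linarith) h0
    calc n = C₀⁻¹ * (C₀ * n) := by field_simp
      _ ≤ C₀⁻¹ * (2 * M * f) := mul_le_mul_of_nonneg_left h5 (by positivity)
      _ = 2 * (C₀⁻¹ * M) * f := by ring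

end Weighted

end

/-! ### From the weighted estimate to the operator norm. -/

section

variable {d : ℕ} {S : System d} {B : BoundaryCondition S}

lemma norm_mulReal_mulOp_le {w : Space d → ℂ} (hw : MemLp w ∞ S.μ) {η : Space d → ℝ}
    (hη : MemLp η ∞ S.μ) {C : ℝ} (hC : 0 ≤ C) (h : ∀ x ∈ tsupport w, |η x| ≤ C) (f : S.L2) :
    ‖S.mulReal η hη (S.mulOp (hw.toLp w) f)‖ ≤ C * (eLpNorm w ∞ S.μ).toReal * ‖f‖ := by
  refine S.norm_mulOp_apply_le hη.ofReal ?_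
  filter_upwards [S.mulOp_ae hw f, S.ae_norm_le_eLpNorm hw] with x h1 h2
  rw [h1]
  by_cases hx : x ∈ tsupport w
  · rw [norm_mul, norm_mul, ← mul_assoc]
    have h3 : ‖((η x : ℝ) : ℂ)‖ ≤ C := by
      rw [Complex.norm_real]
      exact h x hx
    exact mul_le_mul_of_nonneg_right (mul_le_mul h3 h2 (norm_nonneg _) hC) (norm_nonneg _)
  · rw [image_eq_zero_of_notMem_tsupport hx, zero_mul, mul_zero, norm_zero]
    positivity

lemma norm_mulOp_le_mulReal {v : Space d → ℂ} (hv : MemLp v ∞ S.μ) {η : Space d → ℝ}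
    (hη : MemLp η ∞ S.μ) {C : ℝ} (hC : 0 ≤ C) (h : ∀ x ∈ tsupport v, 1 ≤ C * |η x|) (f : S.L2) :
    ‖S.mulOp (hv.toLp v) f‖ ≤ (eLpNorm v ∞ S.μ).toReal * C * ‖S.mulReal η hη f‖ := by
  refine S.norm_mulOp_apply_le hv ?_
  filter_upwards [System.mulReal_ae (hf := hη) f, S.ae_norm_le_eLpNorm hv] with x h1 h2
  rw [h1]
  by_cases hx : x ∈ tsupport v
  · rw [norm_mul, norm_mul, Complex.norm_real, Real.norm_eq_abs]
    have h3 : ‖f x‖ ≤ C * |η x| * ‖f x‖ := le_mul_of_one_le_left (norm_nonneg _) (h x hx)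
    calc ‖v x‖ * ‖f x‖ ≤ (eLpNorm v ∞ S.μ).toReal * (C * |η x| * ‖f x‖) :=
          mul_le_mul h2 h3 (norm_nonneg _) ENNReal.toReal_nonneg
      _ = _ := by ring
  · rw [image_eq_zero_of_notMem_tsupport hx, zero_mul, norm_zero]
    positivity

/-- Every point of the line through a point of the gap is in the resolvent set. -/
lemma mem_resolventSet_of_gap {Em E Ep : ℝ} (hgap : IsSpectralGap B.hamiltonian Em Ep)
    (hE : Em < E) (hE' : E < Ep) (ε : ℝ) :
    (E : ℂ) + (ε : ℂ) * Complex.I ∈ resolventSet B.hamiltonian := by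
  obtain ⟨R, hR⟩ := hgap.2.1 E ⟨hE, hE'⟩
  exact mem_resolventSet_of_isUnit hR
    (isUnit_one_sub_mul_I_smul (BoundaryCondition.isSelfAdjoint_resolvent hR) ε)

/-- The estimate with a truncated weight. -/
lemma norm_resolvent_le_truncArctan {Em E Ep C₀ Ct : ℝ}
    (hgap : IsSpectralGap B.hamiltonian Em Ep) (hE : Em < E) (hE' : E < Ep)
    {v w : Space d → ℂ} (hv : MemLp v ∞ S.μ) (hw : MemLp w ∞ S.μ) {j : Space d → ℝ} {δ : ℝ}
    (hj : IsMollifier j δ) {ρ : Space d → ℝ}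
    (hρ : ρ = smoothDist j (periodize B.periods (tsupport v))) {β κ r : ℝ}
    (hβ : β = beta S (gradNorm S ρ) C₀ Ct Em E Ep) (hκ : κ = kappa C₀ Ct Em E Ep)
    (hr : r = setDist (periodize B.periods (tsupport v)) (tsupport w))
    (hadm : Admissible B ρ β C₀ Ct) (ε : ℝ) {N : ℝ} (hN : 0 < N) :
    ‖S.mulOp (hv.toLp v) ∘L resolvent B.hamiltonian ((E : ℂ) + (ε : ℂ) * Complex.I) ∘L
        S.mulOp (hw.toLp w)‖
      ≤ 2 * (C₀⁻¹ * max ((Ep + Ct) / ((1 - κ ^ 2) * (Ep - E))) ((Em + Ct) / (E - Em)))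
        * (eLpNorm v ∞ S.μ).toReal * (eLpNorm w ∞ S.μ).toReal
        * (Real.exp (β * δ) * Real.exp (-β * truncArctan N (r - δ))) := by
  have hC := hadm.pos
  have hG0 : 0 ≤ gradNorm S ρ := ENNReal.toReal_nonneg
  have hβ0 : 0 ≤ β := hβ ▸ beta_nonneg hG0
  have hZ : 0 < Em + Ct := by
    obtain ⟨R, hR⟩ := hgap.2.1 E ⟨hE, hE'⟩
    have := BoundaryCondition.lower_bound_le_of_gap hgap hE hadm.form_lower_bound hR
    linarith
  have hρc : ContDiff ℝ ∞ ρ := hρ ▸ contDiff_smoothDist hj _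
  have hρ0 : ∀ x, 0 ≤ ρ x := hρ ▸ smoothDist_nonneg hj _
  have hρ1 : ∀ x, ‖fderiv ℝ ρ x‖ ≤ 1 := hρ ▸ norm_fderiv_smoothDist_le hj _
  have hρd : ∀ x, |ρ x - Metric.infDist x (periodize B.periods (tsupport v))| ≤ δ :=
    hρ ▸ abs_smoothDist_sub_infDist_le hj _
  have hρg : MemLp (gradient ρ) ∞ S.μ := hρ ▸ memLp_gradient_smoothDist S hj _
  have hρp : ∀ γ ∈ B.periods, ∀ x, ρ (x + γ) = ρ x := fun γ hγ x => by
    rw [hρ]; exact smoothDist_periodize_add _ hγ x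
  have hθ := isMultiplier_truncArctan_comp hN hρc hρ1
  have hη := isMultiplier_exp_neg_mul hθ hβ0 fun x => truncArctan_nonneg hN (hρ0 x)
  set M := max ((Ep + Ct) / ((1 - κ ^ 2) * (Ep - E))) ((Em + Ct) / (E - Em)) with hM
  have hM0 : 0 ≤ M := le_trans (div_nonneg hZ.le (by linarith)) (le_max_right _ _)
  have hnv : 0 ≤ (eLpNorm v ∞ S.μ).toReal := ENNReal.toReal_nonneg
  have hnw : 0 ≤ (eLpNorm w ∞ S.μ).toReal := ENNReal.toReal_nonneg
  refine ContinuousLinearMap.opNorm_le_bound _ (by positivity) fun g => ?_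
  obtain ⟨hmem, hsol⟩ := BoundaryCondition.form_resolvent
    (isResolventAt_resolvent (mem_resolventSet_of_gap hgap hE hE' ε)) (S.mulOp (hw.toLp w) g)
  have h1 := norm_exp_mul_le hgap hE hE' hρg hadm hβ0
    (hκ ▸ kappa_sq_identity hC hE hE' hZ) (hκ ▸ one_sub_kappa_sq_pos hC hE hE' hZ)
    (hκ ▸ hβ ▸ beta_sq_le hG0 hC hE hE' hZ) hθ
    (fun x => by
      rw [norm_gradient, norm_gradient]
      exact norm_fderiv_truncArctan_comp_le hN hρc x)
    (fun γ hγ x => by rw [hρp γ hγ]) hη ε ⟨_, hmem⟩ _ hsol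
  -- On `supp w` the periodized distance is at least `r`, hence `ρ ≥ r - δ`.
  have h2 := norm_mulReal_mulOp_le hw (S := S) hη.memLp
    (Real.exp_pos (-β * truncArctan N (r - δ))).le (fun x hx => by
      rw [abs_of_pos (Real.exp_pos _), Real.exp_le_exp]
      have e1 := setDist_le_infDist (periodize B.periods (tsupport v)) hx
      have e2 := (abs_le.1 (hρd x)).1
      have e3 : truncArctan N (r - δ) ≤ truncArctan N (ρ x) :=
        truncArctan_mono hN (by linarith)
      nlinarith) g
  -- On `supp v` the distance vanishes, so `θ ≤ ρ ≤ δ` and removing the weight costs at most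
  -- `e^{βδ}`.
  have h3 := norm_mulOp_le_mulReal hv (S := S) hη.memLp (Real.exp_pos (β * δ)).le (fun x hx => by
      rw [abs_of_pos (Real.exp_pos _), ← Real.exp_add, Real.one_le_exp_iff]
      have e1 := Metric.infDist_zero_of_mem (subset_periodize B.periods _ hx)
      have e2 := (abs_le.1 (hρd x)).2
      have e3 := truncArctan_le_self hN (hρ0 x)
      rw [e1] at e2
      nlinarith) (resolvent B.hamiltonian ((E : ℂ) + (ε : ℂ) * Complex.I)
        (S.mulOp (hw.toLp w) g))
  calc _ ≤ _ := h3
    _ ≤ (eLpNorm v ∞ S.μ).toReal * Real.exp (β * δ) * (2 * (C₀⁻¹ * M) *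
        (Real.exp (-β * truncArctan N (r - δ)) * (eLpNorm w ∞ S.μ).toReal * ‖g‖)) := by
      refine mul_le_mul_of_nonneg_left (h1.trans ?_) (by positivity)
      exact mul_le_mul_of_nonneg_left h2 (by positivity)
    _ = _ := by ring

end

end MagneticSchrodinger

end

/-! ### The theorem: removal of the truncation. -/

theorem mainTheorem11 :
    ∃ K : ℝ, 0 < K ∧
      ∀ (d : ℕ) (S : MagneticSchrodinger.System d)
        (B : MagneticSchrodinger.BoundaryCondition S) (Em E Ep : ℝ),
        MagneticSchrodinger.IsSpectralGap B.hamiltonian Em Ep → Em < E → E < Ep →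
      ∀ (v w : MagneticSchrodinger.Space d → ℂ)
        (hv : MemLp v ∞ S.μ) (hw : MemLp w ∞ S.μ),
        HasCompactSupport v → HasCompactSupport w →
      ∀ (j : MagneticSchrodinger.Space d → ℝ) (δ : ℝ), MagneticSchrodinger.IsMollifier j δ →
      ∀ (ρ : MagneticSchrodinger.Space d → ℝ) (C₀ Ct β κ r : ℝ),
        ρ = MagneticSchrodinger.smoothDist j
          (MagneticSchrodinger.periodize B.periods (tsupport v)) →
        β = MagneticSchrodinger.beta S (MagneticSchrodinger.gradNorm S ρ) C₀ Ct Em E Ep →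
        κ = MagneticSchrodinger.kappa C₀ Ct Em E Ep →
        r = MagneticSchrodinger.setDist
          (MagneticSchrodinger.periodize B.periods (tsupport v)) (tsupport w) →
        MagneticSchrodinger.Admissible B ρ β C₀ Ct →
      ∀ ε : ℝ,
        ((E : ℂ) + (ε : ℂ) * Complex.I) ∈ MagneticSchrodinger.resolventSet B.hamiltonian ∧
        ‖S.mulOp (hv.toLp v) ∘L
            MagneticSchrodinger.resolvent B.hamiltonian ((E : ℂ) + (ε : ℂ) * Complex.I) ∘L
            S.mulOp (hw.toLp w)‖
          ≤ K * Real.exp (2 * β * δ)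
            * (C₀⁻¹ * max ((Ep + Ct) / ((1 - κ ^ 2) * (Ep - E))) ((Em + Ct) / (E - Em)))
            * (eLpNorm v ∞ S.μ).toReal * (eLpNorm w ∞ S.μ).toReal * Real.exp (-β * r) := by

  refine ⟨2, by norm_num, ?_⟩
  intro d S B Em E Ep hgap hE hE' v w hv hw _ _ j δ hj ρ C₀ Ct β κ r hρ hβ hκ hr hadm ε
  refine ⟨MagneticSchrodinger.mem_resolventSet_of_gap hgap hE hE' ε, ?_⟩
  -- The truncated bound holds for every `N = n + 1` with a constant independent of `N`, so `n → ∞`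
  -- replaces the truncation of `r - δ` by `r - δ` itself, whatever its sign.
  have h1 := (((MagneticSchrodinger.tendsto_truncArctan (r - δ)).const_mul (-β)).rexp).const_mul
    (Real.exp (β * δ))
  refine (ge_of_tendsto (h1.const_mul (2 * (C₀⁻¹ * max ((Ep + Ct) / ((1 - κ ^ 2) * (Ep - E)))
    ((Em + Ct) / (E - Em))) * (eLpNorm v ∞ S.μ).toReal * (eLpNorm w ∞ S.μ).toReal))
    (Filter.Eventually.of_forall fun n => MagneticSchrodinger.norm_resolvent_le_truncArctan
      hgap hE hE' hv hw hj hρ hβ hκ hr hadm ε (N := (n + 1 : ℝ)) (by positivity))).trans_eq ?_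
  have h2 : Real.exp (β * δ) * Real.exp (-β * (r - δ))
      = Real.exp (2 * β * δ) * Real.exp (-β * r) := by
    rw [← Real.exp_add, ← Real.exp_add]
    congr 1
    ring
  rw [h2]
  ring
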